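/- Consider randomized protocols in the message-passing model: $k$ sites with unlimited memory and computational power exchange nonempty bit-string messages point-to-point. The transcript so far determines which site speaks next or that the protocol has ended, and at the end which site reports the answer. The recipient and content of a message, and the reported answer, depend only on the acting site's own input, its own random tape, and the messages it has itself sent or received. The random tapes may have any joint distribution (so both private and shared randomness are covered). The cost of a protocol is the maximum, over all admissible inputs and all random tapes, of the total number of bits sent. In the connectivity problem with edge duplication, site $i$ holds a graph $G_i$ on the vertex set $V$, $|V|=n$ (the same edge may be held by several sites), and the sites must decide whether $G=\bigcup_{i=1}^k G_i$ is connected. For an input promise $D$, let $R^{1/3}_D(\text{connectivity})$ be the minimum cost, over inputs in $D$, of a protocol that, for every input in $D$, gives the correct answer with probability at least $2/3$ over the random tapes. There are absolute constants $C>0$ and $c>0$ such that for all natural numbers $n,m,k$ with $m\ge n$ and $C\log_2 n\le k\le\min\{n,m\}$, $$R^{1/3}_{D}(\text{connectivity with edge duplication})\;\ge\; c\,\frac{kn}{\log_2 k},$$ where $D$ is the set of inputs for which $G$ has at least $n$ and at most $2m$ edges. In particular, the same bound $\Omega(kn/\log k)$ holds for protocols that are required to be correct on all inputs. (For $k\le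 1$ the right-hand side is read as $0$.) -/

import Mathlib

open MeasureTheory
open scoped ENNReal

namespace MessagePassing

/-- A message sent from one of `k` players to another: a nonempty bit string, with its addresses. -/
structure Packet (k : ℕ) where
  sender : Fin k
  receiver : Fin k
  body : {w : List Bool // w ≠ []}

/-- The chronological list of all messages exchanged so far. -/
abbrev Transcript (k : ℕ) := List (Packet k)

/-- The part of a transcript that player `i` sees: the messages that `i` itself sent or received.
The communication is point-to-point, so the other messages are invisible to `i`. -/
def view {k : ℕ} (i : Fin k) (h : Transcript k) : Transcript k :=
  h.filter fun p => p.sender = i ∨ p.receiver = i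

/-- The total number of bits of the messages in a transcript. -/
def bits {k : ℕ} (h : Transcript k) : ℕ :=
  (h.map fun p => p.body.1.length).sum

/-- A randomized protocol of `k` players with inputs in `X` and answers in `Z`, in the
message-passing model. Player `i` has a random tape in `Tape i`; the joint law of the tapes is an
arbitrary probability measure, so that private tapes (a product measure) and shared randomness
(correlated tapes) are both covered. The transcript specifies which player speaks next, or that the
protocol has ended (`none`), and then which player reports the answer. Whom a player addresses,
what it says and what it answers depend only on its own input, its own tape and the messages
it has sent or received. Computational power and memory of the players are unlimited. -/
structure Protocol (k : ℕ) (X Z : Type) where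
  Tape : Fin k → Type
  [tapeSpace : ∀ i, MeasurableSpace (Tape i)]
  law : Measure (∀ i, Tape i)
  [isProbabilityMeasure_law : IsProbabilityMeasure law]
  next : Transcript k → Option (Fin k)
  send : ∀ i : Fin k, X → Tape i → Transcript k → Fin k × {w : List Bool // w ≠ []}
  reporter : Transcript k → Fin k
  answer : ∀ i : Fin k, X → Tape i → Transcript k → Z

namespace Protocol

variable {k : ℕ} {X Z : Type}

/-- One step of the execution on input `x` with tapes `ω`; a finished execution stays as it is. -/
def step (P : Protocol k X Z) (x : Fin k → X) (ω : ∀ i, P.Tape i) (h : Transcript k) :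
    Transcript k :=
  match P.next h with
  | none => h
  | some i => h ++ [⟨i, (P.send i (x i) (ω i) (view i h)).1, (P.send i (x i) (ω i) (view i h)).2⟩]

/-- The transcript after `t` steps. -/
def history (P : Protocol k X Z) (x : Fin k → X) (ω : ∀ i, P.Tape i) (t : ℕ) : Transcript k :=
  (P.step x ω)^[t] []

/-- On input `x` with tapes `ω` the protocol ends, and the reporting player answers `z`. -/
def Outputs (P : Protocol k X Z) (x : Fin k → X) (ω : ∀ i, P.Tape i) (z : Z) : Prop :=
  ∃ t : ℕ, P.next (P.history x ω t) = none ∧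
    P.answer (P.reporter (P.history x ω t)) (x (P.reporter (P.history x ω t)))
      (ω (P.reporter (P.history x ω t)))
      (view (P.reporter (P.history x ω t)) (P.history x ω t)) = z

/-- On every input in `D`, the protocol gives the answer `f x` except with probability at most
`δ` over the random tapes. -/
def Computes (P : Protocol k X Z) (D : Set (Fin k → X)) (f : (Fin k → X) → Z) (δ : ℝ≥0∞) : Prop :=
  ∀ x ∈ D, letI := P.tapeSpace; P.law {ω | ¬ P.Outputs x ω (f x)} ≤ δ

/-- The worst-case number of bits sent, over all inputs in `D` and all random tapes
(infinite if it is unbounded, in particular if some execution does not end). -/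
noncomputable def cost (P : Protocol k X Z) (D : Set (Fin k → X)) : ℕ∞ :=
  ⨆ x ∈ D, ⨆ (ω : ∀ i, P.Tape i) (t : ℕ), (bits (P.history x ω t) : ℕ∞)

end Protocol

/-- The randomized `δ`-error communication complexity `R^δ(f)` of `f` on the input set `D`. -/
noncomputable def randComm {k : ℕ} {X Z : Type} (D : Set (Fin k → X)) (f : (Fin k → X) → Z)
    (δ : ℝ≥0∞) : ℕ∞ :=
  ⨅ (P : Protocol k X Z) (_ : P.Computes D f δ), P.cost D

/-- The graph `G` whose edges are distributed over the sites: site `i` holds the subgraph `x i`. -/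
def unionGraph {k n : ℕ} (x : Fin k → SimpleGraph (Fin n)) : SimpleGraph (Fin n) :=
  ⨆ i, x i

/-- The inputs with edge duplication allowed (an edge may be held by any number of sites) for which
the union graph, on `n` vertices, has at least `a` and at most `b` edges. -/
def duplicationInputs (k n a b : ℕ) : Set (Fin k → SimpleGraph (Fin n)) :=
  {x | a ≤ (unionGraph x).edgeSet.ncard ∧ (unionGraph x).edgeSet.ncard ≤ b}

open Classical in
/-- The connectivity problem: is the union graph connected? -/
noncomputable def connectivity {k n : ℕ} (x : Fin k → SimpleGraph (Fin n)) : Bool :=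
  decide (unionGraph x).Connected

end MessagePassing

/-! The distinguished site holds a set `y` of coordinates and every other site `i` a set `X i`; the
graph built from them is connected exactly when some `X i` meets `y`. Under the hard law the `X i`
are conditionally independent given `y` and disjoint from `y`. Planting one common point `j` in `X
i` and `y` makes the graph connected, so on average over `i` and `j` it must raise the probability
of accepting by at least 1/3 (`le_sum_accepts`).

Fix a site `i`. Its view, together with the answer, cuts the inputs into rectangles
(`label_update`), and by conditional independence the inputs of the remaining sites act as private
randomness of the holder of `y`. This leaves a two-party disjointness problem. Given a random set
`D`, the two inputs are independent and uniform on the subsets of `D` and of its complement. The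
level-one inequality bounds the total squared Hellinger effect of single bits by the entropy
deficiency of a rectangle (`sum_hellinger_le`), and a Kraft inequality bounds the average deficiency
by the expected length of the view. A cut-and-paste inequality combines the effects of the two bits
at `j` into the effect of the planted point (`planted_advantage_le`).

Hence each view must be long: of order `n / log k` bits on average. A message occurs in at most two
views, so summing over `i` gives `kn / log k`. The logarithm is lost in the Kraft inequality, since
a one-bit message also carries one of `k ^ 2` pairs of addresses. -/

namespace MessagePassing

/-! ### Level-one inequality and Hellinger influences on the discrete cube. -/

section Cube

variable {ι : Type*} [DecidableEq ι]

/-- The sign `±1` of a bit. -/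
def bitSign (b : Bool) : ℝ := if b then 1 else -1

/-- The bits of `x` at the positions in `D`, and zeros elsewhere. -/
def mask (x D : ι → Bool) : ι → Bool := fun j => x j && D j

theorem mask_update_of_true {D : ι → Bool} {j : ι} (h : D j = true) (x : ι → Bool) (τ : Bool) :
    mask (Function.update x j τ) D = Function.update (mask x D) j τ := by
  ext l
  by_cases hl : l = j
  · subst hl; simp [mask, h]
  · simp [mask, hl]

theorem update_mask_of_false {D : ι → Bool} {j : ι} (h : D j = false) (x : ι → Bool) :
    Function.update (mask x D) j false = mask x D := by
  ext l
  by_cases hl : l = j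
  · subst hl; simp [mask, h]
  · simp [hl]

theorem update_mask_update (x D : ι → Bool) (j : ι) (τ σ : Bool) :
    Function.update (mask x (Function.update D j σ)) j τ = Function.update (mask x D) j τ := by
  ext l
  by_cases hl : l = j
  · subst hl; simp
  · simp [mask, hl]

variable [Fintype ι]

theorem sum_exp_signed (c : ι → ℝ) :
    ∑ x : ι → Bool, Real.exp (∑ j, c j * bitSign (x j)) =
      ∏ j, (2 * Real.cosh (c j)) := by
  have h := Finset.prod_univ_sum (fun _ : ι => (Finset.univ : Finset Bool))
    (fun j b => Real.exp (c j * bitSign b))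
  rw [Fintype.piFinset_univ] at h
  simp only [Real.exp_sum]
  rw [← h]
  refine Finset.prod_congr rfl fun j _ => ?_
  simp [bitSign, Real.cosh_eq]
  ring

theorem sum_exp_signed_le (c : ι → ℝ) :
    ∑ x : ι → Bool, Real.exp (∑ j, c j * bitSign (x j)) ≤
      2 ^ Fintype.card ι * Real.exp ((∑ j, c j ^ 2) / 2) := by
  rw [sum_exp_signed, Finset.prod_mul_distrib, Finset.sum_div, Real.exp_sum]
  simp only [Finset.prod_const, Finset.card_univ]
  refine mul_le_mul_of_nonneg_left ?_ (by positivity)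
  refine Finset.prod_le_prod (fun j _ => (Real.cosh_pos _).le) fun j _ => ?_
  exact Real.cosh_le_exp_half_sq _

/-- The level-one inequality for functions on the discrete cube. -/
theorem level_one (f : (ι → Bool) → ℝ) (h0 : ∀ x, 0 ≤ f x) (h1 : ∀ x, f x ≤ 1) :
    ∑ j, (∑ x, f x * bitSign (x j)) ^ 2 ≤
      2 * (∑ x, f x) ^ 2 * Real.log (2 ^ Fintype.card ι / ∑ x, f x) := by
  set p := ∑ x, f x with hp
  have hp0 : 0 ≤ p := Finset.sum_nonneg fun x _ => h0 x
  rcases hp0.eq_or_lt with hz | hpos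
  · have hf : ∀ x, f x = 0 := fun x =>
      (Finset.sum_eq_zero_iff_of_nonneg (fun x _ => h0 x)).1 hz.symm x (Finset.mem_univ x)
    simp [hf, ← hz]
  -- Under the density `f / p`, the linear form with coefficients `c j / p` has mean `R`. Its
  -- exponential moment is at least `exp R` by the tangent line of `exp` at `R`, and at most `2 ^ n
  -- / p * exp (R / 2)`, with `n = card ι`, by `cosh t ≤ exp (t ^ 2 / 2)`.
  set c : ι → ℝ := fun j => ∑ x, f x * bitSign (x j) with hc
  set R := ∑ j, (c j / p) ^ 2 with hR
  have hmean : ∑ x, f x * ∑ j, c j / p * bitSign (x j) = p * R := by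
    simp only [Finset.mul_sum, hR]
    rw [Finset.sum_comm]
    refine Finset.sum_congr rfl fun j _ => ?_
    have : ∀ x, f x * (c j / p * bitSign (x j)) = c j / p * (f x * bitSign (x j)) := fun x => by ring
    simp only [this]
    rw [← Finset.mul_sum]
    change c j / p * c j = _
    field_simp
  have hlow : p * Real.exp R ≤ ∑ x, f x * Real.exp (∑ j, c j / p * bitSign (x j)) := by
    have : ∀ x, f x * (Real.exp R * (1 - R + ∑ j, c j / p * bitSign (x j))) ≤
        f x * Real.exp (∑ j, c j / p * bitSign (x j)) := fun x => by
      refine mul_le_mul_of_nonneg_left ?_ (h0 x)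
      set g := ∑ j, c j / p * bitSign (x j)
      have h := Real.add_one_le_exp (g - R)
      have e : Real.exp g = Real.exp R * Real.exp (g - R) := by rw [← Real.exp_add]; ring_nf
      rw [e]
      exact mul_le_mul_of_nonneg_left (by linarith) (Real.exp_pos _).le
    refine le_trans (le_of_eq ?_) (Finset.sum_le_sum fun x _ => this x)
    have e : ∀ x, f x * (Real.exp R * (1 - R + ∑ j, c j / p * bitSign (x j))) =
        Real.exp R * (1 - R) * f x + Real.exp R * (f x * ∑ j, c j / p * bitSign (x j)) :=
      fun x => by ring
    simp only [e]
    rw [Finset.sum_add_distrib, ← Finset.mul_sum, ← Finset.mul_sum, hmean, ← hp]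
    ring
  have hup : ∑ x, f x * Real.exp (∑ j, c j / p * bitSign (x j)) ≤
      2 ^ Fintype.card ι * Real.exp (R / 2) :=
    (Finset.sum_le_sum fun x _ => mul_le_of_le_one_left (Real.exp_pos _).le (h1 x)).trans
      (sum_exp_signed_le _)
  have hexp : Real.exp (R / 2) ≤ 2 ^ Fintype.card ι / p := by
    have e : Real.exp R = Real.exp (R / 2) * Real.exp (R / 2) := by rw [← Real.exp_add]; ring_nf
    have h := hlow.trans hup
    rw [e] at h
    rw [le_div_iff₀ hpos]
    have := Real.exp_pos (R / 2)
    by_contra! hcon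
    nlinarith
  have hlog : R / 2 ≤ Real.log (2 ^ Fintype.card ι / p) := by
    rw [Real.le_log_iff_exp_le (by positivity)]
    exact hexp
  have hRe : ∑ j, c j ^ 2 = p ^ 2 * R := by
    rw [hR, Finset.mul_sum]
    refine Finset.sum_congr rfl fun j _ => ?_
    field_simp
  change ∑ j, c j ^ 2 ≤ _
  rw [hRe]
  nlinarith [sq_nonneg p]

theorem sum_update_bit (g : (ι → Bool) → ℝ) (j : ι) :
    2 * ∑ x, g x = ∑ x, g (Function.update x j false) + ∑ x, g (Function.update x j true) := by
  have hinv : Function.Involutive fun x : ι → Bool => Function.update x j (!x j) := fun x => by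
    ext l
    by_cases h : l = j
    · subst h; simp
    · simp [h]
  have hflip : ∑ x, g (Function.update x j (!x j)) = ∑ x, g x :=
    Equiv.sum_comp hinv.toPerm g
  rw [two_mul]
  nth_rewrite 2 [← hflip]
  rw [← Finset.sum_add_distrib, ← Finset.sum_add_distrib]
  refine Finset.sum_congr rfl fun x _ => ?_
  have hx : Function.update x j (x j) = x := Function.update_eq_self j x
  cases h : x j
  · rw [h] at hx; simp [hx]
  · rw [h] at hx; simp [hx, add_comm]

/-- The sum of `α` over the subcube of vectors supported in `D`, counted with multiplicity. -/
def cubeSum (α : (ι → Bool) → ℝ) (D : ι → Bool) : ℝ := ∑ x, α (mask x D)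

/-- The same sum with bit `j` replaced by `τ`. -/
def cubeSumAt (α : (ι → Bool) → ℝ) (D : ι → Bool) (j : ι) (τ : Bool) : ℝ :=
  ∑ x, α (Function.update (mask x D) j τ)

theorem cubeSumAt_update (α : (ι → Bool) → ℝ) (D : ι → Bool) (j : ι) (τ σ : Bool) :
    cubeSumAt α (Function.update D j σ) j τ = cubeSumAt α D j τ := by
  simp only [cubeSumAt, update_mask_update]

theorem cubeSumAt_false (α : (ι → Bool) → ℝ) {D : ι → Bool} {j : ι} (h : D j = false) :
    cubeSumAt α D j false = cubeSum α D := by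
  simp only [cubeSumAt, cubeSum, update_mask_of_false h]

theorem two_mul_cubeSum (α : (ι → Bool) → ℝ) {D : ι → Bool} {j : ι} (h : D j = true) :
    2 * cubeSum α D = cubeSumAt α D j false + cubeSumAt α D j true := by
  unfold cubeSum cubeSumAt
  rw [sum_update_bit _ j]
  simp only [mask_update_of_true h]

theorem two_mul_sum_mask_sign (α : (ι → Bool) → ℝ) {D : ι → Bool} {j : ι} (h : D j = true) :
    2 * ∑ x, α (mask x D) * bitSign (x j) = cubeSumAt α D j true - cubeSumAt α D j false := by
  unfold cubeSumAt
  rw [sum_update_bit _ j]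
  simp only [mask_update_of_true h]
  simp [bitSign]
  ring

theorem cubeSumAt_nonneg {α : (ι → Bool) → ℝ} (h0 : ∀ x, 0 ≤ α x) (D : ι → Bool) (j : ι)
    (τ : Bool) : 0 ≤ cubeSumAt α D j τ := Finset.sum_nonneg fun _ _ => h0 _

theorem cubeSum_nonneg {α : (ι → Bool) → ℝ} (h0 : ∀ x, 0 ≤ α x) (D : ι → Bool) :
    0 ≤ cubeSum α D := Finset.sum_nonneg fun _ _ => h0 _

theorem cubeSum_le {α : (ι → Bool) → ℝ} (h1 : ∀ x, α x ≤ 1) (D : ι → Bool) :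
    cubeSum α D ≤ 2 ^ Fintype.card ι := by
  refine (Finset.sum_le_sum fun x _ => h1 _).trans ?_
  simp

theorem sq_sqrt_sub_sqrt_mul_le {a b : ℝ} (ha : 0 ≤ a) (hb : 0 ≤ b) :
    (√a - √b) ^ 2 * (a + b) ≤ (a - b) ^ 2 := by
  obtain ⟨u, hu, rfl⟩ : ∃ u, 0 ≤ u ∧ a = u ^ 2 := ⟨√a, Real.sqrt_nonneg a, (Real.sq_sqrt ha).symm⟩
  obtain ⟨v, hv, rfl⟩ : ∃ v, 0 ≤ v ∧ b = v ^ 2 := ⟨√b, Real.sqrt_nonneg b, (Real.sq_sqrt hb).symm⟩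
  rw [Real.sqrt_sq hu, Real.sqrt_sq hv]
  have e : (u ^ 2 - v ^ 2) ^ 2 = (u - v) ^ 2 * (u + v) ^ 2 := by ring
  rw [e]
  exact mul_le_mul_of_nonneg_left (by nlinarith [mul_nonneg hu hv]) (sq_nonneg _)

/-- The total squared Hellinger influence of a `[0,1]`-valued function on a subcube is at most four
times its entropy deficiency. -/
theorem sum_hellinger_le {α : (ι → Bool) → ℝ} (h0 : ∀ x, 0 ≤ α x) (h1 : ∀ x, α x ≤ 1)
    (D : ι → Bool) :
    ∑ j, (if D j then (√(cubeSumAt α D j true) - √(cubeSumAt α D j false)) ^ 2 else 0) ≤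
      4 * cubeSum α D * Real.log (2 ^ Fintype.card ι / cubeSum α D) := by
  -- The subcube is handled inside the full cube: the masked function ignores the bits outside `D`.
  have hL := level_one (fun x => α (mask x D)) (fun x => h0 _) fun x => h1 _
  change _ ≤ 2 * cubeSum α D ^ 2 * Real.log (_ / cubeSum α D) at hL
  set A := cubeSum α D with hA
  have hA0 : 0 ≤ A := cubeSum_nonneg h0 D
  have key : ∀ j, A * (if D j then
      (√(cubeSumAt α D j true) - √(cubeSumAt α D j false)) ^ 2 else 0) ≤
      2 * (∑ x, α (mask x D) * bitSign (x j)) ^ 2 := fun j => by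
    split_ifs with h
    · have e1 := two_mul_cubeSum α h
      have e2 := two_mul_sum_mask_sign α h
      have := sq_sqrt_sub_sqrt_mul_le (cubeSumAt_nonneg h0 D j true) (cubeSumAt_nonneg h0 D j false)
      rw [← e2] at this
      rw [add_comm (cubeSumAt α D j true), ← e1] at this
      nlinarith
    · rw [mul_zero]; positivity
  rcases hA0.eq_or_lt with hz | hpos
  · rw [← hz]
    simp only [mul_zero, zero_mul]
    refine le_of_eq (Finset.sum_eq_zero fun j _ => ?_)
    split_ifs with h
    · have e1 := two_mul_cubeSum α h
      have ha := cubeSumAt_nonneg h0 D j true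
      have hb := cubeSumAt_nonneg h0 D j false
      have e3 : cubeSumAt α D j true = 0 := by linarith
      have e4 : cubeSumAt α D j false = 0 := by linarith
      simp [e3, e4]
    · rfl
  · have hsum := Finset.sum_le_sum fun j (_ : j ∈ Finset.univ) => key j
    rw [← Finset.mul_sum, ← Finset.mul_sum] at hsum
    have := hsum.trans (mul_le_mul_of_nonneg_left hL zero_le_two)
    refine le_of_mul_le_mul_left (this.trans (le_of_eq ?_)) hpos
    ring

end Cube

/-! ### Two-party disjointness with one planted point. -/

section TwoParty

variable {ι V : Type*} [Fintype ι] [DecidableEq ι] [Fintype V]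

/-- This is `log t ≤ t - 1` at `t = m * exp (-l) / p`. It trades the entropy term for a code length
`l`; the excess `m * exp (-l)` is later summed by Kraft. -/
theorem mul_log_div_le {p m l : ℝ} (hp : 0 ≤ p) (hm : 0 < m) :
    p * Real.log (m / p) ≤ p * l + m * Real.exp (-l) - p := by
  rcases hp.eq_or_lt with rfl | hp
  · simp; positivity
  have h := Real.log_le_sub_one_of_pos (x := m * Real.exp (-l) / p) (by positivity)
  have e : Real.log (m * Real.exp (-l) / p) = Real.log (m / p) - l := by
    rw [mul_div_right_comm, Real.log_mul (by positivity) (by positivity), Real.log_exp]; ring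
  rw [e] at h
  have := mul_le_mul_of_nonneg_left h hp.le
  have e2 : p * (m * Real.exp (-l) / p - 1) = m * Real.exp (-l) - p := by field_simp
  rw [e2] at this
  linarith

/-- As `cubeSum (b v) E` is at most the size of the cube, the deficiency of one side is at most that
of the whole rectangle. The resulting bound is symmetric, so it serves both parties. -/
theorem sum_hellinger_le_length {α b : V → (ι → Bool) → ℝ} (ha0 : ∀ v x, 0 ≤ α v x)
    (ha1 : ∀ v x, α v x ≤ 1) (hb0 : ∀ v x, 0 ≤ b v x) (hb1 : ∀ v x, b v x ≤ 1) (l : V → ℝ)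
    (D E : ι → Bool) (hE : ∀ j, E j = !D j) :
    ∑ j, (if D j then ∑ v, cubeSumAt (b v) E j false *
      (√(cubeSumAt (α v) D j true) - √(cubeSumAt (α v) D j false)) ^ 2 else 0) ≤
      4 * ∑ v, (cubeSum (α v) D * cubeSum (b v) E * l v +
        (2 ^ Fintype.card ι) ^ 2 * Real.exp (-l v) - cubeSum (α v) D * cubeSum (b v) E) := by
  have e : ∀ j, (if D j then ∑ v, cubeSumAt (b v) E j false *
      (√(cubeSumAt (α v) D j true) - √(cubeSumAt (α v) D j false)) ^ 2 else 0) =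
      ∑ v, cubeSum (b v) E * (if D j then
        (√(cubeSumAt (α v) D j true) - √(cubeSumAt (α v) D j false)) ^ 2 else 0) := fun j => by
    split_ifs with h
    · refine Finset.sum_congr rfl fun v _ => ?_
      rw [cubeSumAt_false (b v) (by rw [hE, h]; rfl)]
    · simp
  simp only [e]
  rw [Finset.sum_comm, Finset.mul_sum]
  refine Finset.sum_le_sum fun v _ => ?_
  rw [← Finset.mul_sum]
  have hA := cubeSum_nonneg (ha0 v) D
  have hB := cubeSum_nonneg (hb0 v) E
  have hBM := cubeSum_le (hb1 v) E
  set A := cubeSum (α v) D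
  set B := cubeSum (b v) E
  set M : ℝ := 2 ^ Fintype.card ι with hM
  have hMpos : 0 < M := by positivity
  refine (mul_le_mul_of_nonneg_left (sum_hellinger_le (ha0 v) (ha1 v) D) hB).trans ?_
  have h1 := mul_log_div_le (l := l v) (mul_nonneg hA hB) (pow_pos hMpos 2)
  have h2 : A * B * Real.log (M / A) ≤ A * B * Real.log (M ^ 2 / (A * B)) := by
    rcases hA.eq_or_lt with hz | hA
    · simp [← hz]
    rcases hB.eq_or_lt with hz | hB
    · simp [← hz]
    refine mul_le_mul_of_nonneg_left (Real.log_le_log (by positivity) ?_) (by positivity)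
    rw [div_le_div_iff₀ hA (by positivity)]
    nlinarith [mul_pos hMpos hA]
  calc B * (4 * A * Real.log (M / A)) = 4 * (A * B * Real.log (M / A)) := by ring
    _ ≤ _ := by linarith

/-- In terms of the square roots `p, q, r, s` of `a₀, a₁, b₀, b₁`, the right side minus the left is
exactly `(r * (q - p) + p * (s - r)) ^ 2`. The last bracket vanishes when summed over a partition
into rectangles. -/
theorem cut_paste (a₀ a₁ b₀ b₁ : ℝ) (ha₀ : 0 ≤ a₀) (ha₁ : 0 ≤ a₁) (hb₀ : 0 ≤ b₀) (hb₁ : 0 ≤ b₁) :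
    (√(a₁ * b₁) - √(a₀ * b₀)) ^ 2 ≤ 2 * (b₀ * (√a₁ - √a₀) ^ 2 + a₀ * (√b₁ - √b₀) ^ 2) +
      (a₁ * b₁ + a₀ * b₀ - a₁ * b₀ - a₀ * b₁) := by
  obtain ⟨p, hp, rfl⟩ : ∃ u, 0 ≤ u ∧ a₀ = u ^ 2 := ⟨√a₀, Real.sqrt_nonneg _, (Real.sq_sqrt ha₀).symm⟩
  obtain ⟨q, hq, rfl⟩ : ∃ u, 0 ≤ u ∧ a₁ = u ^ 2 := ⟨√a₁, Real.sqrt_nonneg _, (Real.sq_sqrt ha₁).symm⟩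
  obtain ⟨r, hr, rfl⟩ : ∃ u, 0 ≤ u ∧ b₀ = u ^ 2 := ⟨√b₀, Real.sqrt_nonneg _, (Real.sq_sqrt hb₀).symm⟩
  obtain ⟨s, hs, rfl⟩ : ∃ u, 0 ≤ u ∧ b₁ = u ^ 2 := ⟨√b₁, Real.sqrt_nonneg _, (Real.sq_sqrt hb₁).symm⟩
  rw [← mul_pow, ← mul_pow, Real.sqrt_sq (by positivity), Real.sqrt_sq (by positivity),
    Real.sqrt_sq hp, Real.sqrt_sq hq, Real.sqrt_sq hr, Real.sqrt_sq hs]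
  nlinarith [sq_nonneg (r * (q - p) + p * (s - r))]

/-- AM-GM applied to `|√p - √q| * (√p + √q)`, with a free balance `t`. -/
theorem abs_sub_le_hellinger {p q t : ℝ} (hp : 0 ≤ p) (hq : 0 ≤ q) (ht : 0 < t) :
    |p - q| ≤ t / 2 * (√p - √q) ^ 2 + (p + q) / t := by
  obtain ⟨u, hu, rfl⟩ : ∃ u, 0 ≤ u ∧ p = u ^ 2 := ⟨√p, Real.sqrt_nonneg _, (Real.sq_sqrt hp).symm⟩
  obtain ⟨v, hv, rfl⟩ : ∃ u, 0 ≤ u ∧ q = u ^ 2 := ⟨√q, Real.sqrt_nonneg _, (Real.sq_sqrt hq).symm⟩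
  rw [Real.sqrt_sq hu, Real.sqrt_sq hv]
  have hfac : t / 2 * (u - v) ^ 2 + (u ^ 2 + v ^ 2) / t =
      (t ^ 2 * (u - v) ^ 2 + 2 * (u ^ 2 + v ^ 2)) / (2 * t) := by field_simp
  rw [hfac, abs_le', le_div_iff₀ (by positivity), le_div_iff₀ (by positivity)]
  constructor
  · nlinarith [sq_nonneg (t * (u - v) - (u + v)), sq_nonneg (u - v)]
  · nlinarith [sq_nonneg (t * (u - v) + (u + v)), sq_nonneg (u - v)]

end TwoParty

section TwoPartyBound

variable {ι V : Type*} [DecidableEq ι]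

/-- The complement of a set given by its indicator. -/
def compl (D : ι → Bool) : ι → Bool := fun j => !D j

theorem compl_update (D : ι → Bool) (j : ι) (σ : Bool) :
    compl (Function.update D j σ) = Function.update (compl D) j (!σ) := by
  ext l
  by_cases hl : l = j
  · subst hl; simp [compl]
  · simp [compl, hl]

variable [Fintype ι]

theorem sum_eq_two_mul_sum_if (g : (ι → Bool) → ℝ) (j : ι) (τ : Bool)
    (hg : ∀ D σ, g (Function.update D j σ) = g D) :
    ∑ D, g D = 2 * ∑ D, (if D j = τ then g D else 0) := by
  rw [sum_update_bit _ j]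
  cases τ <;> simp [hg]

variable [Fintype V]

/-- The total mass of the rectangles does not depend on the bits `σ` and `τ`; this is what cancels
the mixed terms of `cut_paste`. -/
theorem sum_cubeSumAt_mul {α b : V → (ι → Bool) → ℝ}
    (hn : ∀ x y, ∑ v, α v x * b v y = 1) (D E : ι → Bool) (j : ι) (σ τ : Bool) :
    ∑ v, cubeSumAt (α v) D j σ * cubeSumAt (b v) E j τ = (2 ^ Fintype.card ι) ^ 2 := by
  simp only [cubeSumAt, Finset.sum_mul_sum]
  rw [Finset.sum_comm]
  have : ∀ x : ι → Bool, ∑ v, ∑ y, α v (Function.update (mask x D) j σ) *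
      b v (Function.update (mask y E) j τ) = 2 ^ Fintype.card ι := fun x => by
    rw [Finset.sum_comm]
    simp [hn]
  simp only [this]
  simp [sq]

theorem sum_cubeSum_mul {α b : V → (ι → Bool) → ℝ}
    (hn : ∀ x y, ∑ v, α v x * b v y = 1) (D E : ι → Bool) :
    ∑ v, cubeSum (α v) D * cubeSum (b v) E = (2 ^ Fintype.card ι) ^ 2 := by
  simp only [cubeSum, Finset.sum_mul_sum]
  rw [Finset.sum_comm]
  have : ∀ x : ι → Bool, ∑ v, ∑ y, α v (mask x D) *
      b v (mask y E) = 2 ^ Fintype.card ι := fun x => by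
    rw [Finset.sum_comm]
    simp [hn]
  simp only [this]
  simp [sq]

/-- A two-party disjointness bound: a family of rectangles of small expected length on disjoint
inputs cannot notice that the two inputs intersect in a single planted point. -/
theorem planted_advantage_le {α b : V → (ι → Bool) → ℝ} (ha0 : ∀ v x, 0 ≤ α v x)
    (ha1 : ∀ v x, α v x ≤ 1) (hb0 : ∀ v x, 0 ≤ b v x) (hb1 : ∀ v x, b v x ≤ 1)
    (hn : ∀ x y, ∑ v, α v x * b v y = 1) (l o : V → ℝ) (ho0 : ∀ v, 0 ≤ o v) (ho1 : ∀ v, o v ≤ 1) :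
    ∑ j, ∑ D : ι → Bool, ∑ v, o v *
      (cubeSumAt (α v) D j true * cubeSumAt (b v) (compl D) j true -
        cubeSumAt (α v) D j false * cubeSumAt (b v) (compl D) j false) ≤
      192 * ∑ D : ι → Bool, ∑ v, l v * (cubeSum (α v) D * cubeSum (b v) (compl D)) +
      192 * (2 ^ Fintype.card ι) ^ 3 * (∑ v, Real.exp (-l v) - 1) +
      (2 ^ Fintype.card ι) ^ 3 * Fintype.card ι / 6 := by
  set M : ℝ := 2 ^ Fintype.card ι with hM
  set h₁ : ι → (ι → Bool) → ℝ := fun j D => ∑ v, cubeSumAt (b v) (compl D) j false *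
      (√(cubeSumAt (α v) D j true) - √(cubeSumAt (α v) D j false)) ^ 2 with hh₁
  set h₂ : ι → (ι → Bool) → ℝ := fun j D => ∑ v, cubeSumAt (α v) D j false *
      (√(cubeSumAt (b v) (compl D) j true) - √(cubeSumAt (b v) (compl D) j false)) ^ 2 with hh₂
  set X : (ι → Bool) → ℝ := fun D => ∑ v, (cubeSum (α v) D * cubeSum (b v) (compl D) * l v +
        M ^ 2 * Real.exp (-l v) - cubeSum (α v) D * cubeSum (b v) (compl D)) with hX
  have hpoint : ∀ j D, ∑ v, o v *
      (cubeSumAt (α v) D j true * cubeSumAt (b v) (compl D) j true -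
        cubeSumAt (α v) D j false * cubeSumAt (b v) (compl D) j false) ≤
      12 * (h₁ j D + h₂ j D) + M ^ 2 / 6 := fun j D => by
    have hv : ∀ v, o v * (cubeSumAt (α v) D j true * cubeSumAt (b v) (compl D) j true -
        cubeSumAt (α v) D j false * cubeSumAt (b v) (compl D) j false) ≤
        12 * (cubeSumAt (b v) (compl D) j false *
          (√(cubeSumAt (α v) D j true) - √(cubeSumAt (α v) D j false)) ^ 2) +
        12 * (cubeSumAt (α v) D j false *
          (√(cubeSumAt (b v) (compl D) j true) - √(cubeSumAt (b v) (compl D) j false)) ^ 2) +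
        6 * (cubeSumAt (α v) D j true * cubeSumAt (b v) (compl D) j true +
          cubeSumAt (α v) D j false * cubeSumAt (b v) (compl D) j false -
          cubeSumAt (α v) D j true * cubeSumAt (b v) (compl D) j false -
          cubeSumAt (α v) D j false * cubeSumAt (b v) (compl D) j true) +
        (cubeSumAt (α v) D j true * cubeSumAt (b v) (compl D) j true +
          cubeSumAt (α v) D j false * cubeSumAt (b v) (compl D) j false) / 12 := fun v => by
      have A0 := cubeSumAt_nonneg (ha0 v) D j false
      have A1 := cubeSumAt_nonneg (ha0 v) D j true
      have B0 := cubeSumAt_nonneg (hb0 v) (compl D) j false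
      have B1 := cubeSumAt_nonneg (hb0 v) (compl D) j true
      have c := cut_paste _ _ _ _ A0 A1 B0 B1
      -- With `t = 12` the additive loss is `M ^ 2 / 6`, half of the advantage 1/3 that correctness
      -- will demand.
      have t := abs_sub_le_hellinger (t := 12) (mul_nonneg A1 B1) (mul_nonneg A0 B0) (by norm_num)
      have u : o v * (cubeSumAt (α v) D j true * cubeSumAt (b v) (compl D) j true -
          cubeSumAt (α v) D j false * cubeSumAt (b v) (compl D) j false) ≤
          |cubeSumAt (α v) D j true * cubeSumAt (b v) (compl D) j true -
          cubeSumAt (α v) D j false * cubeSumAt (b v) (compl D) j false| :=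
        (mul_le_mul_of_nonneg_left (le_abs_self _) (ho0 v)).trans
          (mul_le_of_le_one_left (abs_nonneg _) (ho1 v))
      linarith
    refine (Finset.sum_le_sum fun v _ => hv v).trans (le_of_eq ?_)
    simp only [Finset.sum_add_distrib, ← Finset.mul_sum, Finset.sum_sub_distrib, ← Finset.sum_div,
      sum_cubeSumAt_mul hn, hh₁, hh₂]
    ring
  -- `h₁ j D` does not depend on `D j`, so it may be averaged over the `D` containing `j`. For
  -- these, bit `j` of the other party is masked to `false`, as the subcube bound requires.
  have i₁ : ∀ j, ∑ D, h₁ j D = 2 * ∑ D, (if D j then h₁ j D else 0) := fun j =>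
    sum_eq_two_mul_sum_if _ j true fun D σ => by
      simp only [hh₁, compl_update, cubeSumAt_update]
  have i₂ : ∀ j, ∑ D, h₂ j D = 2 * ∑ D, (if compl D j then h₂ j D else 0) := fun j => by
    rw [sum_eq_two_mul_sum_if (h₂ j) j false fun D σ => by
      simp only [hh₂, compl_update, cubeSumAt_update]]
    simp [compl]
  have b₁ : ∀ D, ∑ j, (if D j then h₁ j D else 0) ≤ 4 * X D := fun D =>
    sum_hellinger_le_length ha0 ha1 hb0 hb1 l D (compl D) fun j => rfl
  have b₂ : ∀ D, ∑ j, (if compl D j then h₂ j D else 0) ≤ 4 * X D := fun D => by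
    have := sum_hellinger_le_length hb0 hb1 ha0 ha1 l (compl D) D fun j => by simp [compl]
    refine this.trans (le_of_eq ?_)
    simp only [hX, hM, mul_comm (cubeSum (b _) (compl D)) (cubeSum (α _) D)]
  have s₁ : ∑ j, ∑ D, h₁ j D ≤ 8 * ∑ D, X D := by
    simp only [i₁]
    rw [← Finset.mul_sum, Finset.sum_comm]
    have := Finset.sum_le_sum fun D (_ : D ∈ Finset.univ) => b₁ D
    rw [← Finset.mul_sum] at this
    linarith
  have s₂ : ∑ j, ∑ D, h₂ j D ≤ 8 * ∑ D, X D := by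
    simp only [i₂]
    rw [← Finset.mul_sum, Finset.sum_comm]
    have := Finset.sum_le_sum fun D (_ : D ∈ Finset.univ) => b₂ D
    rw [← Finset.mul_sum] at this
    linarith
  have hXs : ∑ D, X D = ∑ D : ι → Bool, ∑ v, l v * (cubeSum (α v) D * cubeSum (b v) (compl D)) +
      M ^ 3 * (∑ v, Real.exp (-l v) - 1) := by
    simp only [hX, Finset.sum_add_distrib, Finset.sum_sub_distrib, sum_cubeSum_mul hn,
      ← Finset.mul_sum, mul_comm (_ * _) (l _)]
    simp [← hM]
    ring
  refine (Finset.sum_le_sum fun j _ => Finset.sum_le_sum fun D _ => hpoint j D).trans ?_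
  simp only [Finset.sum_add_distrib, ← Finset.mul_sum]
  simp only [Finset.sum_const, Finset.card_univ, Fintype.card_pi, Fintype.card_bool,
    Finset.prod_const, nsmul_eq_mul]
  push_cast
  rw [← hM]
  nlinarith

end TwoPartyBound

/-! ### Kraft inequalities for words and transcripts. -/

section Kraft

variable {A : Type*}

/-- A Kraft inequality for lists: if the weights of the letters sum to at most `s < 1`, then the
weights of the words sum to at most `1 / (1 - s)`. -/
theorem sum_list_weight_le (w : A → ℝ) (hw : ∀ a, 0 ≤ w a) {s : ℝ} (hs0 : 0 ≤ s) (hs : s < 1)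
    (h : ∀ S : Finset A, ∑ a ∈ S, w a ≤ s) (S : Finset (List A)) :
    ∑ v ∈ S, (v.map w).prod ≤ 1 / (1 - s) := by
  classical
  have hnn : ∀ v : List A, 0 ≤ (v.map w).prod := fun v =>
    List.prod_nonneg fun a ha => by
      obtain ⟨b, _, rfl⟩ := List.mem_map.1 ha
      exact hw b
  have hs' : 0 < 1 - s := by linarith
  have main : ∀ L : ℕ, ∀ S : Finset (List A), (∀ v ∈ S, v.length < L) →
      ∑ v ∈ S, (v.map w).prod ≤ 1 / (1 - s) := by
    intro L
    induction L with
    | zero =>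
      intro S hS
      have : S = ∅ := Finset.eq_empty_of_forall_notMem fun v hv => by simpa using hS v hv
      simp only [this, Finset.sum_empty]
      positivity
    | succ L ih =>
      intro S hS
      -- A nonempty word is a letter followed by a shorter word, and the bound `B = 1 / (1 - s)`
      -- solves `1 + s * B = B`.
      set heads : Finset A := S.biUnion fun v => v.head?.toFinset with hheads
      set tails : Finset (List A) := (S.filter (· ≠ [])).image List.tail with htails
      have hsub : S ⊆ insert [] ((heads ×ˢ tails).image fun p => p.1 :: p.2) := by
        intro v hv
        rcases v with _ | ⟨a, t⟩
        · simp
        · refine Finset.mem_insert_of_mem (Finset.mem_image.2 ⟨(a, t), ?_, rfl⟩)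
          refine Finset.mem_product.2 ⟨Finset.mem_biUnion.2 ⟨_, hv, by simp⟩, ?_⟩
          exact Finset.mem_image.2 ⟨a :: t, by simp [hv], rfl⟩
      have htl : ∑ v ∈ tails, (v.map w).prod ≤ 1 / (1 - s) := by
        refine ih tails fun v hv => ?_
        obtain ⟨u, hu, rfl⟩ := Finset.mem_image.1 hv
        obtain ⟨hu, hne⟩ := Finset.mem_filter.1 hu
        have := hS u hu
        rcases u with _ | ⟨a, t⟩
        · exact absurd rfl hne
        · simpa using this
      calc ∑ v ∈ S, (v.map w).prod
          ≤ ∑ v ∈ insert [] ((heads ×ˢ tails).image fun p => p.1 :: p.2), (v.map w).prod :=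
            Finset.sum_le_sum_of_subset_of_nonneg hsub fun v _ _ => hnn v
        _ = 1 + ∑ p ∈ heads ×ˢ tails, ((p.1 :: p.2).map w).prod := by
            rw [Finset.sum_insert (by simp), Finset.sum_image]
            · simp
            · rintro ⟨a, t⟩ _ ⟨b, u⟩ _ hab
              simpa using hab
        _ = 1 + (∑ a ∈ heads, w a) * ∑ v ∈ tails, (v.map w).prod := by
            rw [Finset.sum_product, Finset.sum_mul_sum]
            simp
        _ ≤ 1 + s * (1 / (1 - s)) := by
            have := Finset.sum_nonneg fun v (_ : v ∈ tails) => hnn v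
            gcongr
            exact h heads
        _ = 1 / (1 - s) := by field_simp; ring
  refine main (S.sup List.length + 1) S fun v hv => ?_
  exact Nat.lt_succ_of_le (Finset.le_sup (f := List.length) hv)

theorem prod_map_pow_eq {k : ℕ} (q : ℝ) (h : Transcript k) :
    (h.map fun p => q ^ p.body.1.length).prod = q ^ bits h := by
  induction h with
  | nil => simp [bits]
  | cons p t ih =>
    simp only [List.map_cons, List.prod_cons, ih, bits, List.sum_cons, pow_add]

theorem sum_bool_list_le (q : ℝ) (hq0 : 0 ≤ q) (hq : q ≤ 1 / 4) (S : Finset (List Bool))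
    (hS : [] ∉ S) : ∑ w ∈ S, q ^ w.length ≤ 4 * q := by
  classical
  have key := sum_list_weight_le (fun _ : Bool => q) (fun _ => hq0) (s := 2 * q) (by linarith)
    (by linarith) (fun T => by
      have : (T.card : ℝ) ≤ 2 := by exact_mod_cast (Finset.card_le_univ T)
      simp only [Finset.sum_const, nsmul_eq_mul]
      nlinarith) (insert [] S)
  rw [Finset.sum_insert hS] at key
  simp only [List.map_const', List.prod_replicate, List.length_nil, pow_zero] at key
  have : 1 / (1 - 2 * q) ≤ 1 + 4 * q := by
    rw [div_le_iff₀ (by linarith)]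
    nlinarith
  linarith

/-- A Kraft inequality for transcripts. -/
theorem sum_transcript_le {k : ℕ} (hk : 1 ≤ k) (S : Finset (Transcript k)) :
    ∑ h ∈ S, (1 / (8 * (k : ℝ) ^ 2)) ^ bits h ≤ 2 := by
  classical
  have hk' : (1 : ℝ) ≤ k := by exact_mod_cast hk
  -- Nonempty bodies have total weight at most `4 * q`, so with `k ^ 2` address pairs all packets
  -- together weigh at most 1/2.
  set q : ℝ := 1 / (8 * (k : ℝ) ^ 2) with hq
  have hq0 : 0 ≤ q := by positivity
  have hq4 : q ≤ 1 / 4 := by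
    rw [hq, div_le_div_iff₀ (by positivity) (by norm_num)]
    nlinarith
  have key := sum_list_weight_le (fun p : Packet k => q ^ p.body.1.length)
    (fun _ => by positivity) (s := 1 / 2) (by norm_num) (by norm_num) (fun T => ?_) S
  · simp only [prod_map_pow_eq] at key
    norm_num at key
    exact key
  · set B := T.image fun p => p.body.1 with hB
    have hBne : [] ∉ B := fun h => by
      obtain ⟨p, _, hp⟩ := Finset.mem_image.1 h
      exact p.body.2 hp
    have hsum : ∑ p ∈ T, q ^ p.body.1.length =
        ∑ t ∈ T.image (fun p : Packet k => (p.sender, p.receiver, p.body.1)), q ^ t.2.2.length := by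
      rw [Finset.sum_image]
      rintro ⟨a, b, c⟩ _ ⟨a', b', c'⟩ _ hab
      simp only [Prod.mk.injEq] at hab
      obtain ⟨rfl, rfl, hc⟩ := hab
      simp [Subtype.ext hc]
    rw [hsum]
    have hsub : T.image (fun p : Packet k => (p.sender, p.receiver, p.body.1)) ⊆
        Finset.univ ×ˢ Finset.univ ×ˢ B := fun t ht => by
      obtain ⟨p, hp, rfl⟩ := Finset.mem_image.1 ht
      simp only [Finset.mem_product, Finset.mem_univ, true_and]
      exact Finset.mem_image_of_mem _ hp
    refine (Finset.sum_le_sum_of_subset_of_nonneg hsub fun _ _ _ => by positivity).trans ?_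
    rw [Finset.sum_product]
    simp only [Finset.sum_product, Finset.sum_const, Finset.card_univ, Fintype.card_fin,
      nsmul_eq_mul]
    calc (k : ℝ) * (k * ∑ w ∈ B, q ^ w.length) ≤ k * (k * (4 * q)) := by
          gcongr
          exact sum_bool_list_le q hq0 hq4 B hBne
      _ = 1 / 2 := by rw [hq]; field_simp; norm_num

end Kraft

/-! ### Views of a transcript. -/

section Views

variable {k : ℕ}

theorem view_append (i : Fin k) (h : Transcript k) (p : Packet k) :
    view i (h ++ [p]) = if p.sender = i ∨ p.receiver = i then view i h ++ [p] else view i h := by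
  unfold view
  rw [List.filter_append]
  split_ifs with hp
  · simp [hp]
  · simp [hp]

theorem view_prefix {i : Fin k} {g h : Transcript k} (hgh : g <+: h) : view i g <+: view i h :=
  hgh.filter _

theorem bits_append (g h : Transcript k) : bits (g ++ h) = bits g + bits h := by
  simp [bits]

/-- Every message is seen by at most two players. -/
theorem sum_bits_view_le (h : Transcript k) : ∑ i, bits (view i h) ≤ 2 * bits h := by
  induction h using List.reverseRecOn with
  | nil => simp [view, bits]
  | append_singleton h p ih =>
    have hp : ∀ i, bits (view i (h ++ [p])) ≤ bits (view i h) +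
        ((if p.sender = i then bits [p] else 0) + (if p.receiver = i then bits [p] else 0)) := by
      intro i
      rw [view_append]
      by_cases h1 : p.sender = i <;> by_cases h2 : p.receiver = i <;> simp [h1, h2, bits_append]
    refine (Finset.sum_le_sum fun i _ => hp i).trans ?_
    rw [Finset.sum_add_distrib, Finset.sum_add_distrib, bits_append]
    simp
    omega

end Views

/-! ### Executions of a protocol and their rectangle property. -/

namespace Protocol

variable {k : ℕ} {X Z : Type} (P : Protocol k X Z)

theorem history_succ (x : Fin k → X) (ω : ∀ i, P.Tape i) (t : ℕ) :
    P.history x ω (t + 1) = P.step x ω (P.history x ω t) :=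
  Function.iterate_succ_apply' _ _ _

theorem step_of_none {x : Fin k → X} {ω : ∀ i, P.Tape i} {h : Transcript k}
    (hn : P.next h = none) : P.step x ω h = h := by
  unfold step
  rw [hn]

theorem step_of_some {x : Fin k → X} {ω : ∀ i, P.Tape i} {h : Transcript k} {i : Fin k}
    (hn : P.next h = some i) : P.step x ω h =
      h ++ [⟨i, (P.send i (x i) (ω i) (view i h)).1, (P.send i (x i) (ω i) (view i h)).2⟩] := by
  unfold step
  rw [hn]

theorem history_prefix (x : Fin k → X) (ω : ∀ i, P.Tape i) {s t : ℕ} (hst : s ≤ t) :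
    P.history x ω s <+: P.history x ω t := by
  induction t, hst using Nat.le_induction with
  | base => exact List.prefix_rfl
  | succ t _ ih =>
    refine ih.trans ?_
    rw [history_succ]
    cases hn : P.next (P.history x ω t) with
    | none => rw [P.step_of_none hn]
    | some i => rw [P.step_of_some hn]; exact List.prefix_append _ _

theorem history_eq_of_next_eq_none {x : Fin k → X} {ω : ∀ i, P.Tape i} {s t : ℕ} (hst : s ≤ t)
    (hn : P.next (P.history x ω s) = none) : P.history x ω t = P.history x ω s := by
  induction t, hst using Nat.le_induction with
  | base => rfl
  | succ t _ ih => rw [history_succ, ih, P.step_of_none hn]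

/-- Messages are nonempty, so each step before the end costs at least one bit. Hence a protocol of
cost `c` has stopped after `c + 1` steps. -/
theorem le_bits_history {x : Fin k → X} {ω : ∀ i, P.Tape i} {t : ℕ}
    (hn : P.next (P.history x ω t) ≠ none) : ∀ s ≤ t, s ≤ bits (P.history x ω s) := by
  intro s hs
  induction s with
  | zero => exact Nat.zero_le _
  | succ s ih =>
    have hs' : P.next (P.history x ω s) ≠ none := fun h => by
      rw [← P.history_eq_of_next_eq_none (by omega : s ≤ t) h] at h
      exact hn h
    obtain ⟨i, hi⟩ := Option.ne_none_iff_exists'.1 hs'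
    rw [history_succ, P.step_of_some hi, bits_append]
    have := ih (by omega)
    have hpos : 0 < ((P.send i (x i) (ω i) (view i (P.history x ω s))).2.1).length :=
      List.length_pos_iff.2 (P.send i (x i) (ω i) (view i (P.history x ω s))).2.2
    simp only [bits, List.map_cons, List.map_nil, List.sum_cons, List.sum_nil] at this ⊢
    omega

theorem bits_history_le {D : Set (Fin k → X)} {c : ℕ} (hc : P.cost D ≤ c) {x : Fin k → X}
    (hx : x ∈ D) (ω : ∀ i, P.Tape i) (t : ℕ) : bits (P.history x ω t) ≤ c := by
  have h : (bits (P.history x ω t) : ℕ∞) ≤ P.cost D :=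
    le_iSup₂_of_le x hx (le_iSup₂_of_le ω t le_rfl)
  exact_mod_cast h.trans hc

theorem next_history_eq_none {D : Set (Fin k → X)} {c : ℕ} (hc : P.cost D ≤ c) {x : Fin k → X}
    (hx : x ∈ D) (ω : ∀ i, P.Tape i) : P.next (P.history x ω (c + 1)) = none := by
  by_contra hn
  have h1 := P.le_bits_history hn (c + 1) le_rfl
  have h2 := P.bits_history_le hc hx ω (c + 1)
  omega

/-- The answer that would be reported if the protocol was stopped after `T` steps. -/
def result (x : Fin k → X) (ω : ∀ i, P.Tape i) (T : ℕ) : Z :=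
  P.answer (P.reporter (P.history x ω T)) (x (P.reporter (P.history x ω T)))
    (ω (P.reporter (P.history x ω T))) (view (P.reporter (P.history x ω T)) (P.history x ω T))

theorem outputs_iff {D : Set (Fin k → X)} {c : ℕ} (hc : P.cost D ≤ c) {x : Fin k → X}
    (hx : x ∈ D) (ω : ∀ i, P.Tape i) (z : Z) :
    P.Outputs x ω z ↔ P.result x ω (c + 1) = z := by
  have hn := P.next_history_eq_none hc hx ω
  constructor
  · rintro ⟨t, ht, rfl⟩
    have e : P.history x ω (c + 1) = P.history x ω t := by
      rcases le_total t (c + 1) with h | h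
      · exact P.history_eq_of_next_eq_none h ht
      · exact (P.history_eq_of_next_eq_none h hn).symm
    unfold result
    rw [e]
  · intro h
    exact ⟨c + 1, hn, h⟩

/-- With input `a` and tape `r`, player `i` would send the messages that the view `v` records. -/
def Consistent (i : Fin k) (a : X) (r : P.Tape i) (v : Transcript k) : Prop :=
  ∀ u p, u ++ [p] <+: v → p.sender = i → P.send i a r u = (p.receiver, p.body)

theorem consistent_history (x : Fin k → X) (ω : ∀ i, P.Tape i) (i : Fin k) (t : ℕ) :
    P.Consistent i (x i) (ω i) (view i (P.history x ω t)) := by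
  induction t with
  | zero =>
    intro u p hp
    simp [history, view] at hp
  | succ t ih =>
    rw [history_succ]
    cases hn : P.next (P.history x ω t) with
    | none => rwa [P.step_of_none hn]
    | some l =>
      rw [P.step_of_some hn, view_append]
      split_ifs with hl
      · intro u p hp hpi
        rcases List.prefix_concat_iff.1 hp with h | h
        · obtain ⟨rfl, hp'⟩ := List.append_inj' h rfl
          obtain rfl := List.singleton_injective hp'
          subst hpi
          rfl
        · exact ih u p h hpi
      · exact ih

/-- Induction on time: a speaker other than `i` has the same input and view in both runs, and `i`
repeats its messages by consistency. -/
theorem history_eq_of_consistent {x x' : Fin k → X} {ω : ∀ i, P.Tape i} {i : Fin k} {T : ℕ}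
    (hx : ∀ l, l ≠ i → x' l = x l)
    (hc : P.Consistent i (x' i) (ω i) (view i (P.history x ω T))) :
    ∀ t ≤ T, P.history x' ω t = P.history x ω t := by
  intro t ht
  induction t with
  | zero => rfl
  | succ t ih =>
    have e := ih (by omega)
    rw [history_succ, history_succ, e]
    cases hn : P.next (P.history x ω t) with
    | none => rw [P.step_of_none hn, P.step_of_none hn]
    | some l =>
      rw [P.step_of_some hn, P.step_of_some hn]
      by_cases hl : l = i
      · subst hl
        have hpre := view_prefix (i := l) (P.history_prefix x ω ht)
        rw [history_succ, P.step_of_some hn, view_append, if_pos (Or.inl rfl)] at hpre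
        have := hc _ _ hpre rfl
        rw [this]
      · rw [hx l hl]

/-- What player `i` learns from an execution, together with the answer and the information whether
`i` reports it. -/
def label (ω : ∀ i, P.Tape i) (T : ℕ) (i : Fin k) (x : Fin k → X) : Transcript k × Bool × Z :=
  (view i (P.history x ω T), decide (P.reporter (P.history x ω T) = i), P.result x ω T)

/-- The inputs with a given label form a rectangle. -/
theorem label_update (ω : ∀ i, P.Tape i) (T : ℕ) (i : Fin k) {x x' : Fin k → X}
    (h : P.label ω T i x = P.label ω T i x') :
    P.label ω T i (Function.update x' i (x i)) = P.label ω T i x' := by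
  simp only [label, Prod.mk.injEq, decide_eq_decide] at h
  obtain ⟨hv, hr, hz⟩ := h
  have hcons := P.consistent_history x ω i T
  rw [hv] at hcons
  have hh : P.history (Function.update x' i (x i)) ω T = P.history x' ω T :=
    P.history_eq_of_consistent (i := i) (fun l hl => by simp [hl]) (by simpa using hcons) T le_rfl
  simp only [label, hh, Prod.mk.injEq, true_and]
  -- If `i` reports, the answer depends on its input and view, both shared with the run on `x`,
  -- where `i` also reports by the flag in the label. Otherwise the input of the reporter is
  -- unchanged.
  by_cases hi : P.reporter (P.history x' ω T) = i
  · rw [← hz]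
    have hi' := hr.2 hi
    unfold result
    rw [hh]
    generalize P.reporter (P.history x' ω T) = r at hi
    generalize P.reporter (P.history x ω T) = r' at hi'
    subst hi
    subst hi'
    rw [← hv]
    simp
  · unfold result
    rw [hh, Function.update_of_ne hi]

end Protocol

/-! ### The hard distribution and the reduction to two parties. -/

section ManyParty

variable {ι L : Type*} [Fintype ι] [Fintype L]

/-- The conditional law of a bit of a player, given the bit of the distinguished player. -/
noncomputable def bitWeight (y x : Bool) : ℝ :=
  if y then (if x then 0 else 1) else (if x then 1 / 3 else 2 / 3)

theorem bitWeight_nonneg (y x : Bool) : 0 ≤ bitWeight y x := by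
  unfold bitWeight
  split_ifs <;> norm_num

/-- The law of the bit of the distinguished player. -/
noncomputable def priorWeight (y : Bool) : ℝ := if y then 1 / 4 else 3 / 4

/-- The conditional law of the input of one player. -/
noncomputable def inputWeight (y a : ι → Bool) : ℝ := ∏ j, bitWeight (y j) (a j)

theorem inputWeight_nonneg (y a : ι → Bool) : 0 ≤ inputWeight y a :=
  Finset.prod_nonneg fun _ _ => bitWeight_nonneg _ _

theorem disjoint_of_inputWeight_ne_zero {y a : ι → Bool} (h : inputWeight y a ≠ 0) (j : ι) :
    ¬ (a j = true ∧ y j = true) := by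
  rintro ⟨ha, hy⟩
  refine h (Finset.prod_eq_zero (Finset.mem_univ j) ?_)
  simp [bitWeight, ha, hy]

/-- The conditional law of the inputs of all the players. -/
noncomputable def jointWeight (y : ι → Bool) (X : L → ι → Bool) : ℝ := ∏ l, inputWeight y (X l)

theorem jointWeight_nonneg (y : ι → Bool) (X : L → ι → Bool) : 0 ≤ jointWeight y X :=
  Finset.prod_nonneg fun _ _ => inputWeight_nonneg _ _

variable [DecidableEq ι]

theorem sum_prod_cube (g : ι → Bool → ℝ) : ∑ x : ι → Bool, ∏ j, g j (x j) = ∏ j, ∑ b, g j b := by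
  rw [Finset.prod_univ_sum, Fintype.piFinset_univ]

theorem sum_inputWeight (y : ι → Bool) : ∑ a, inputWeight y a = 1 := by
  unfold inputWeight
  rw [sum_prod_cube]
  refine Finset.prod_eq_one fun j _ => ?_
  cases y j <;> simp [bitWeight]
  norm_num

variable [DecidableEq L]

theorem sum_jointWeight (y : ι → Bool) : ∑ X : L → ι → Bool, jointWeight y X = 1 := by
  unfold jointWeight
  have := Finset.prod_univ_sum (fun _ : L => (Finset.univ : Finset (ι → Bool)))
    (fun _ a => inputWeight y a)
  rw [Fintype.piFinset_univ] at this
  rw [← this]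
  simp [sum_inputWeight]

/-- Exchanging `X i` with the fresh sample `a` preserves the product weight. -/
theorem sum_resample (y : ι → Bool) (i : L) (G : (L → ι → Bool) → ℝ) :
    ∑ a, inputWeight y a * ∑ X, jointWeight y X * G (Function.update X i a) =
      ∑ X, jointWeight y X * G X := by
  have hinv : Function.Involutive fun p : (ι → Bool) × (L → ι → Bool) =>
      (p.2 i, Function.update p.2 i p.1) := fun p => by
    ext <;> simp
  have h := Equiv.sum_comp hinv.toPerm
    (fun p : (ι → Bool) × (L → ι → Bool) => inputWeight y p.1 * (jointWeight y p.2 * G p.2))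
  have hw : ∀ p : (ι → Bool) × (L → ι → Bool), inputWeight y (p.2 i) *
      jointWeight y (Function.update p.2 i p.1) = inputWeight y p.1 * jointWeight y p.2 := by
    rintro ⟨a, X⟩
    unfold jointWeight
    rw [← Finset.mul_prod_erase _ _ (Finset.mem_univ i),
      ← Finset.mul_prod_erase _ (fun l => inputWeight y (X l)) (Finset.mem_univ i)]
    have : ∏ l ∈ Finset.univ.erase i, inputWeight y (Function.update X i a l) =
        ∏ l ∈ Finset.univ.erase i, inputWeight y (X l) :=
      Finset.prod_congr rfl fun l hl => by rw [Function.update_of_ne (Finset.ne_of_mem_erase hl)]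
    simp only [Function.update_self, this]
    ring
  simp only [Function.Involutive.coe_toPerm, ← mul_assoc, hw] at h
  simp only [Finset.mul_sum, ← mul_assoc]
  rw [← Fintype.sum_prod_type'
    (f := fun a X => inputWeight y a * jointWeight y X * G (Function.update X i a)), h,
    Fintype.sum_prod_type]
  simp only [mul_assoc]
  rw [← Finset.sum_mul_sum, sum_inputWeight, one_mul]

/-- The law of a pair of masked uniform vectors. -/
theorem sum_mask (H : (ι → Bool) → (ι → Bool) → ℝ) :
    ∑ D : ι → Bool, ∑ x : ι → Bool, ∑ y : ι → Bool, H (mask x D) (mask y (compl D)) =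
      (2 ^ Fintype.card ι) ^ 3 *
        ∑ y, (∏ j, priorWeight (y j)) * ∑ a, inputWeight y a * H a y := by
  set I : Bool → Bool → Bool → Bool → Bool → ℝ := fun a b d u v =>
    if a = (u && d) ∧ b = (v && !d) then 1 else 0 with hI
  have hpt : ∀ D x y : ι → Bool, H (mask x D) (mask y (compl D)) =
      ∑ b, ∑ a, (∏ j, I (a j) (b j) (D j) (x j) (y j)) * H a b := fun D x y => by
    rw [Finset.sum_eq_single (mask y (compl D)), Finset.sum_eq_single (mask x D)]
    · simp [hI, mask, compl]
    · intro a _ ha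
      obtain ⟨j, hj⟩ := Function.ne_iff.1 ha
      rw [Finset.prod_eq_zero (Finset.mem_univ j), zero_mul]
      exact if_neg fun h => hj h.1
    · simp
    · intro b _ hb
      obtain ⟨j, hj⟩ := Function.ne_iff.1 hb
      refine Finset.sum_eq_zero fun a _ => ?_
      rw [Finset.prod_eq_zero (Finset.mem_univ j), zero_mul]
      exact if_neg fun h => hj h.2
    · simp
  have hcount : ∀ a b : ι → Bool, ∑ D : ι → Bool, ∑ x : ι → Bool, ∑ y : ι → Bool,
      ∏ j, I (a j) (b j) (D j) (x j) (y j) =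
      (2 ^ Fintype.card ι) ^ 3 * ((∏ j, priorWeight (b j)) * inputWeight b a) := fun a b => by
    have h1 : ∀ D x : ι → Bool, ∑ y : ι → Bool, ∏ j, I (a j) (b j) (D j) (x j) (y j) =
        ∏ j, ∑ v, I (a j) (b j) (D j) (x j) v := fun D x =>
      sum_prod_cube fun j v => I (a j) (b j) (D j) (x j) v
    have h2 : ∀ D : ι → Bool, ∑ x : ι → Bool, ∏ j, ∑ v, I (a j) (b j) (D j) (x j) v =
        ∏ j, ∑ u, ∑ v, I (a j) (b j) (D j) u v := fun D =>
      sum_prod_cube fun j u => ∑ v, I (a j) (b j) (D j) u v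
    simp only [h1, h2]
    rw [sum_prod_cube fun j d => ∑ u, ∑ v, I (a j) (b j) d u v]
    rw [inputWeight, ← Finset.prod_mul_distrib, ← pow_mul, mul_comm (Fintype.card ι), pow_mul,
      ← Finset.card_univ, ← Finset.prod_const, ← Finset.prod_mul_distrib]
    -- Per coordinate, the triples (mask, bit, bit) that yield a given pair number `8 * priorWeight
    -- * bitWeight`; this fixes the constants 1/4 and 1/3.
    refine Finset.prod_congr rfl fun j _ => ?_
    cases a j <;> cases b j <;>
      simp [hI, priorWeight, bitWeight] <;> norm_num [Finset.filter_insert,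
        Finset.filter_singleton]
  simp only [hpt]
  have swap : ∑ D : ι → Bool, ∑ x : ι → Bool, ∑ y : ι → Bool, ∑ b, ∑ a,
      (∏ j, I (a j) (b j) (D j) (x j) (y j)) * H a b =
      ∑ b, ∑ a, (∑ D : ι → Bool, ∑ x : ι → Bool, ∑ y : ι → Bool,
        ∏ j, I (a j) (b j) (D j) (x j) (y j)) * H a b := by
    simp only [Finset.sum_mul]
    have e1 : ∀ D x : ι → Bool, ∑ y : ι → Bool, ∑ b, ∑ a,
        (∏ j, I (a j) (b j) (D j) (x j) (y j)) * H a b = ∑ b, ∑ a, ∑ y : ι → Bool,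
        (∏ j, I (a j) (b j) (D j) (x j) (y j)) * H a b := fun D x => by
      rw [Finset.sum_comm]
      exact Finset.sum_congr rfl fun b _ => Finset.sum_comm
    have e2 : ∀ D : ι → Bool, ∑ x : ι → Bool, ∑ b, ∑ a, ∑ y : ι → Bool,
        (∏ j, I (a j) (b j) (D j) (x j) (y j)) * H a b = ∑ b, ∑ a, ∑ x : ι → Bool, ∑ y : ι → Bool,
        (∏ j, I (a j) (b j) (D j) (x j) (y j)) * H a b := fun D => by
      rw [Finset.sum_comm]
      exact Finset.sum_congr rfl fun b _ => Finset.sum_comm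
    simp only [e1, e2]
    rw [Finset.sum_comm]
    exact Finset.sum_congr rfl fun b _ => Finset.sum_comm
  rw [swap]
  simp only [hcount, Finset.mul_sum]
  refine Finset.sum_congr rfl fun b _ => Finset.sum_congr rfl fun a _ => by ring

/-- The total length of what the players see, averaged over the hard inputs. -/
theorem sum_masked_length_le (len : L → (L → ι → Bool) → (ι → Bool) → ℝ) (B : ℝ)
    (hB : ∀ X y, ∑ i, len i X y ≤ B) :
    ∑ i, ∑ D : ι → Bool, ∑ x : ι → Bool, ∑ y : ι → Bool, ∑ X, jointWeight (mask y (compl D)) X *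
      len i (Function.update X i (mask x D)) (mask y (compl D)) ≤
      (2 ^ Fintype.card ι) ^ 3 * B := by
  have h : ∀ i, ∑ D : ι → Bool, ∑ x : ι → Bool, ∑ y : ι → Bool, ∑ X,
      jointWeight (mask y (compl D)) X *
      len i (Function.update X i (mask x D)) (mask y (compl D)) =
      (2 ^ Fintype.card ι) ^ 3 * ∑ y : ι → Bool, (∏ j, priorWeight (y j)) *
        ∑ X, jointWeight y X * len i X y := fun i => by
    rw [sum_mask fun a y => ∑ X, jointWeight y X * len i (Function.update X i a) y]
    -- Resampling puts all players under one common law of inputs, so their lengths can be added and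
    -- bounded pointwise by `B`.
    have hs := fun y : ι → Bool => sum_resample y i fun X => len i X y
    simp only [hs]
  simp only [h]
  rw [← Finset.mul_sum, Finset.sum_comm]
  refine mul_le_mul_of_nonneg_left ?_ (by positivity)
  have hy : ∀ y : ι → Bool, ∑ i, (∏ j, priorWeight (y j)) * ∑ X, jointWeight y X * len i X y ≤
      (∏ j, priorWeight (y j)) * B := fun y => by
    rw [← Finset.mul_sum]
    refine mul_le_mul_of_nonneg_left ?_ (Finset.prod_nonneg fun j _ => ?_)
    · rw [Finset.sum_comm]
      simp only [← Finset.mul_sum]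
      refine (Finset.sum_le_sum fun X _ =>
        mul_le_mul_of_nonneg_left (hB X y) (jointWeight_nonneg y X)).trans ?_
      rw [← Finset.sum_mul, sum_jointWeight, one_mul]
    · unfold priorWeight
      split_ifs <;> norm_num
  refine (Finset.sum_le_sum fun y _ => hy y).trans (le_of_eq ?_)
  rw [← Finset.sum_mul, sum_prod_cube fun _ b => priorWeight b]
  simp [priorWeight]
  norm_num

open Classical in
/-- The two-party bound for one player against all others. -/
theorem player_advantage_le {Λ : Type*} (i : L) (F : (L → ι → Bool) → (ι → Bool) → Λ)
    (hF : ∀ X X' y y' a a', F (Function.update X i a) y = F (Function.update X' i a') y' →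
      F (Function.update X' i a) y' = F (Function.update X' i a') y')
    (len o : Λ → ℝ) (ho0 : ∀ v, 0 ≤ o v) (ho1 : ∀ v, o v ≤ 1) {W : ℝ}
    (hW : ∀ S : Finset Λ, ∑ v ∈ S, Real.exp (-len v) ≤ W) :
    ∑ j, ∑ D : ι → Bool, ∑ x : ι → Bool, ∑ y : ι → Bool,
      (∑ X, jointWeight (Function.update (mask y (compl D)) j true) X *
          o (F (Function.update X i (Function.update (mask x D) j true))
            (Function.update (mask y (compl D)) j true)) -
        ∑ X, jointWeight (Function.update (mask y (compl D)) j false) X *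
          o (F (Function.update X i (Function.update (mask x D) j false))
            (Function.update (mask y (compl D)) j false))) ≤
      192 * ∑ D : ι → Bool, ∑ x : ι → Bool, ∑ y : ι → Bool, ∑ X,
        jointWeight (mask y (compl D)) X *
          len (F (Function.update X i (mask x D)) (mask y (compl D))) +
      192 * (2 ^ Fintype.card ι) ^ 3 * (W - 1) +
      (2 ^ Fintype.card ι) ^ 3 * Fintype.card ι / 6 := by
  set V : Finset Λ := Finset.univ.image fun p : (L → ι → Bool) × (ι → Bool) => F p.1 p.2 with hV
  have hmem : ∀ X y, F X y ∈ V := fun X y =>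
    Finset.mem_image.2 ⟨(X, y), Finset.mem_univ _, rfl⟩
  -- Sides of the rectangle with label `v`: `α` sees only the input of player `i`, `β` only the
  -- rest. Averaging `β` over `X` given `y` makes `b` a function of `y` alone.
  set α : V → (ι → Bool) → ℝ := fun v a =>
    if ∃ X y, F (Function.update X i a) y = v then 1 else 0 with hα
  set β : V → (L → ι → Bool) → (ι → Bool) → ℝ := fun v X y =>
    if ∃ a, F (Function.update X i a) y = v then 1 else 0 with hβ
  set b : V → (ι → Bool) → ℝ := fun v y => ∑ X, jointWeight y X * β v X y with hb
  have hαβ : ∀ v a X y, α v a * β v X y =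
      if F (Function.update X i a) y = v then 1 else 0 := fun v a X y => by
    simp only [hα, hβ]
    by_cases h : F (Function.update X i a) y = v
    · rw [if_pos ⟨X, y, h⟩, if_pos ⟨a, h⟩, if_pos h, one_mul]
    · rw [if_neg h]
      by_cases h1 : ∃ X y, F (Function.update X i a) y = v
      · by_cases h2 : ∃ a, F (Function.update X i a) y = v
        · obtain ⟨X₁, y₁, h1⟩ := h1
          obtain ⟨a', h2⟩ := h2
          exact absurd ((hF X₁ X y₁ y a a' (h1.trans h2.symm)).trans h2) h
        · rw [if_neg h2, mul_zero]
      · rw [if_neg h1, zero_mul]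
  have hsum : ∀ (g : Λ → ℝ) a y, ∑ v : V, g v * (α v a * b v y) =
      ∑ X, jointWeight y X * g (F (Function.update X i a) y) := fun g a y => by
    simp only [hb, Finset.mul_sum]
    rw [Finset.sum_comm]
    refine Finset.sum_congr rfl fun X _ => ?_
    have e : ∀ v : V, g v * (α v a * (jointWeight y X * β v X y)) =
        if F (Function.update X i a) y = v then jointWeight y X * g v else 0 := fun v => by
      rw [mul_left_comm (α v a), hαβ]
      split_ifs <;> ring
    simp only [e]
    rw [Finset.sum_eq_single ⟨_, hmem (Function.update X i a) y⟩]
    · simp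
    · intro v _ hv
      exact if_neg fun h => hv (Subtype.ext h.symm)
    · simp
  have hn : ∀ a y, ∑ v, α v a * b v y = 1 := fun a y => by
    have := hsum (fun _ => 1) a y
    simpa [sum_jointWeight] using this
  have hβ0 : ∀ v X y, 0 ≤ β v X y := fun v X y => by simp only [hβ]; split_ifs <;> norm_num
  have hβ1 : ∀ v X y, β v X y ≤ 1 := fun v X y => by simp only [hβ]; split_ifs <;> norm_num
  have main := planted_advantage_le (α := α) (b := b)
    (fun v a => by simp only [hα]; split_ifs <;> norm_num)
    (fun v a => by simp only [hα]; split_ifs <;> norm_num)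
    (fun v y => Finset.sum_nonneg fun X _ => mul_nonneg (jointWeight_nonneg y X) (hβ0 v X y))
    (fun v y => by
      rw [← sum_jointWeight (L := L) y]
      exact Finset.sum_le_sum fun X _ =>
        mul_le_of_le_one_right (jointWeight_nonneg y X) (hβ1 v X y))
    hn (fun v => len v) (fun v => o v) (fun v => ho0 v) fun v => ho1 v
  have hlen : ∀ D : ι → Bool, ∑ v : V, len v * (cubeSum (α v) D * cubeSum (b v) (compl D)) =
      ∑ x, ∑ y, ∑ X, jointWeight (mask y (compl D)) X *
          len (F (Function.update X i (mask x D)) (mask y (compl D))) := fun D => by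
    simp only [← hsum len, cubeSum]
    simp only [Finset.sum_mul_sum]
    simp only [Finset.mul_sum]
    rw [Finset.sum_comm]
    exact Finset.sum_congr rfl fun x _ => Finset.sum_comm
  have hout : ∀ (D : ι → Bool) j τ,
      ∑ v : V, o v * (cubeSumAt (α v) D j τ * cubeSumAt (b v) (compl D) j τ) =
      ∑ x, ∑ y, ∑ X, jointWeight (Function.update (mask y (compl D)) j τ) X *
          o (F (Function.update X i (Function.update (mask x D) j τ))
            (Function.update (mask y (compl D)) j τ)) := fun D j τ => by
    simp only [← hsum o, cubeSumAt]
    simp only [Finset.sum_mul_sum]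
    simp only [Finset.mul_sum]
    rw [Finset.sum_comm]
    exact Finset.sum_congr rfl fun x _ => Finset.sum_comm
  simp only [mul_sub, Finset.sum_sub_distrib, hlen, hout] at main
  simp only [Finset.sum_sub_distrib]
  refine main.trans ?_
  have hWV : ∑ v : V, Real.exp (-len v) ≤ W := by
    rw [Finset.sum_coe_sort V fun v => Real.exp (-len v)]
    exact hW V
  have := mul_le_mul_of_nonneg_left hWV
    (by positivity : (0 : ℝ) ≤ 192 * (2 ^ Fintype.card ι) ^ 3)
  linarith

end ManyParty

/-! ### Encoding disjointness as graph connectivity. -/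

section HardGraphs

variable {N : ℕ}

/-- A vertex of `Fin (5 + N)` for each coordinate. -/
abbrev coordVertex (j : Fin N) : Fin (5 + N) := Fin.natAdd 5 j

/-- One of the five auxiliary vertices. -/
abbrev auxVertex (N : ℕ) (a : Fin 5) : Fin (5 + N) := Fin.castAdd N a

/-- The star with centre `auxVertex 0` at the coordinates of `a`. -/
def starGraph (a : Fin N → Bool) : SimpleGraph (Fin (5 + N)) :=
  SimpleGraph.fromRel fun u v => u = auxVertex N 0 ∧ ∃ j, a j = true ∧ v = coordVertex j

/-- The graph of the distinguished player: the coordinates of `y` are joined to `auxVertex 1`, the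
other coordinates to `auxVertex 0`, and there are five more edges. -/
def baseGraph (y : Fin N → Bool) : SimpleGraph (Fin (5 + N)) :=
  SimpleGraph.fromRel fun u v =>
    (∃ j, y j = true ∧ u = auxVertex N 1 ∧ v = coordVertex j) ∨
    (∃ j, y j = false ∧ u = auxVertex N 0 ∧ v = coordVertex j) ∨
    (u = auxVertex N 0 ∧ v = auxVertex N 2) ∨ (u = auxVertex N 0 ∧ v = auxVertex N 3) ∨
    (u = auxVertex N 0 ∧ v = auxVertex N 4) ∨ (u = auxVertex N 2 ∧ v = auxVertex N 3) ∨
    (u = auxVertex N 2 ∧ v = auxVertex N 4)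

theorem coordVertex_ne_auxVertex (j : Fin N) (a : Fin 5) : coordVertex j ≠ auxVertex N a := by
  intro h
  have := congrArg Fin.val h
  simp at this
  omega

theorem auxVertex_inj {a b : Fin 5} : auxVertex N a = auxVertex N b ↔ a = b :=
  (Fin.castAdd_injective 5 N).eq_iff

/-- The inputs of `K + 1` players. -/
def hardInput {K : ℕ} (X : Fin K → Fin N → Bool) (y : Fin N → Bool) :
    Fin (K + 1) → SimpleGraph (Fin (5 + N)) :=
  Fin.cons (baseGraph y) fun i => starGraph (X i)

theorem hardInput_update {K : ℕ} (X : Fin K → Fin N → Bool) (y : Fin N → Bool) (i : Fin K)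
    (a : Fin N → Bool) :
    hardInput (Function.update X i a) y = Function.update (hardInput X y) i.succ (starGraph a) := by
  unfold hardInput
  rw [← Fin.cons_update]
  congr 1
  ext l : 1
  by_cases h : l = i
  · subst h; simp
  · simp [h]

theorem unionGraph_hardInput_adj {K : ℕ} (X : Fin K → Fin N → Bool) (y : Fin N → Bool)
    (u v : Fin (5 + N)) : (unionGraph (hardInput X y)).Adj u v ↔
      (baseGraph y).Adj u v ∨ ∃ i, (starGraph (X i)).Adj u v := by
  simp only [unionGraph, SimpleGraph.iSup_adj, Fin.exists_fin_succ, hardInput, Fin.cons_zero,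
    Fin.cons_succ]

theorem base_le {K : ℕ} (X : Fin K → Fin N → Bool) (y : Fin N → Bool) :
    baseGraph y ≤ unionGraph (hardInput X y) := fun u v h =>
  (unionGraph_hardInput_adj X y u v).2 (Or.inl h)

/-- The edges of `baseGraph` between auxiliary vertices. -/
def auxEdge : Fin 5 → Fin 5 × Fin 5 := ![(0, 2), (0, 3), (0, 4), (2, 3), (2, 4)]

theorem baseGraph_adj_aux (y : Fin N → Bool) (a : Fin 5) :
    (baseGraph y).Adj (auxVertex N (auxEdge a).1) (auxVertex N (auxEdge a).2) := by
  rw [baseGraph, SimpleGraph.fromRel_adj]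
  simp only [ne_eq, auxVertex_inj]
  refine ⟨by revert a; decide, Or.inl (Or.inr (Or.inr ?_))⟩
  fin_cases a <;> simp [auxEdge]

theorem baseGraph_adj_coord (y : Fin N → Bool) (j : Fin N) :
    (baseGraph y).Adj (auxVertex N (if y j then 1 else 0)) (coordVertex j) := by
  rw [baseGraph, SimpleGraph.fromRel_adj]
  refine ⟨(coordVertex_ne_auxVertex _ _).symm, Or.inl ?_⟩
  cases h : y j
  · exact Or.inr (Or.inl ⟨j, h, rfl, rfl⟩)
  · exact Or.inl ⟨j, h, rfl, rfl⟩

theorem starGraph_adj (a : Fin N → Bool) {j : Fin N} (h : a j = true) :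
    (starGraph a).Adj (auxVertex N 0) (coordVertex j) := by
  rw [starGraph, SimpleGraph.fromRel_adj]
  exact ⟨(coordVertex_ne_auxVertex _ _).symm, Or.inl ⟨rfl, j, h, rfl⟩⟩

theorem unionGraph_hardInput_cases {K : ℕ} {X : Fin K → Fin N → Bool} {y : Fin N → Bool}
    {p : Fin (5 + N) → Fin (5 + N) → Prop} (hp : ∀ u v, p u v → p v u)
    (haux : ∀ a, p (auxVertex N (auxEdge a).1) (auxVertex N (auxEdge a).2))
    (hbase : ∀ j, p (auxVertex N (if y j then 1 else 0)) (coordVertex j))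
    (hstar : ∀ i j, X i j = true → p (auxVertex N 0) (coordVertex j))
    {u v : Fin (5 + N)} (h : (unionGraph (hardInput X y)).Adj u v) : p u v := by
  have key : ∀ u v, ((∃ j, y j = true ∧ u = auxVertex N 1 ∧ v = coordVertex j) ∨
    (∃ j, y j = false ∧ u = auxVertex N 0 ∧ v = coordVertex j) ∨
    (u = auxVertex N 0 ∧ v = auxVertex N 2) ∨ (u = auxVertex N 0 ∧ v = auxVertex N 3) ∨
    (u = auxVertex N 0 ∧ v = auxVertex N 4) ∨ (u = auxVertex N 2 ∧ v = auxVertex N 3) ∨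
    (u = auxVertex N 2 ∧ v = auxVertex N 4)) → p u v := by
    rintro u v (⟨j, hj, rfl, rfl⟩ | ⟨j, hj, rfl, rfl⟩ | ⟨rfl, rfl⟩ | ⟨rfl, rfl⟩ | ⟨rfl, rfl⟩ |
      ⟨rfl, rfl⟩ | ⟨rfl, rfl⟩)
    · simpa [hj] using hbase j
    · simpa [hj] using hbase j
    exacts [haux 0, haux 1, haux 2, haux 3, haux 4]
  rw [unionGraph_hardInput_adj] at h
  simp only [baseGraph, starGraph, SimpleGraph.fromRel_adj] at h
  rcases h with ⟨_, h | h⟩ | ⟨i, _, ⟨rfl, j, hj, rfl⟩ | ⟨rfl, j, hj, rfl⟩⟩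
  · exact key _ _ h
  · exact hp _ _ (key _ _ h)
  · exact hstar i j hj
  · exact hp _ _ (hstar i j hj)

theorem ncard_edgeSet_le {K : ℕ} (X : Fin K → Fin N → Bool) (y : Fin N → Bool) :
    (unionGraph (hardInput X y)).edgeSet.ncard ≤ 2 * (5 + N) := by
  set f : Fin (5 + N) → Sym2 (Fin (5 + N)) := fun u => s(u, auxVertex N 0) with hf
  set g : Fin (5 + N) → Sym2 (Fin (5 + N)) :=
    fun u => s(u, Fin.addCases (fun _ => auxVertex N 2) (fun _ => auxVertex N 1) u) with hg
  have hsub : (unionGraph (hardInput X y)).edgeSet ⊆ f '' Set.univ ∪ g '' Set.univ := by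
    intro e
    induction e using Sym2.ind with
    | _ u v =>
      intro h
      rw [SimpleGraph.mem_edgeSet] at h
      refine unionGraph_hardInput_cases
        (p := fun u v => s(u, v) ∈ f '' Set.univ ∪ g '' Set.univ) ?_ ?_ ?_ ?_ h
      · intro u v h
        rwa [Sym2.eq_swap]
      · intro a
        by_cases h0 : (auxEdge a).1 = 0
        · exact Or.inl ⟨auxVertex N (auxEdge a).2, trivial, by rw [h0]; exact Sym2.eq_swap⟩
        · have h2 : (auxEdge a).1 = 2 := by revert a; decide
          refine Or.inr ⟨auxVertex N (auxEdge a).2, trivial, ?_⟩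
          rw [h2, hg]
          simp only [Fin.addCases_left]
          exact Sym2.eq_swap
      · intro j
        cases y j
        · exact Or.inl ⟨coordVertex j, trivial, Sym2.eq_swap⟩
        · refine Or.inr ⟨coordVertex j, trivial, ?_⟩
          simp only [hg, Fin.addCases_right]
          exact Sym2.eq_swap
      · intro i j _
        exact Or.inl ⟨coordVertex j, trivial, Sym2.eq_swap⟩
  refine (Set.ncard_le_ncard hsub (Set.toFinite _)).trans ((Set.ncard_union_le _ _).trans ?_)
  have h1 := Set.ncard_image_le (f := f) (Set.toFinite Set.univ)
  have h2 := Set.ncard_image_le (f := g) (Set.toFinite Set.univ)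
  rw [Set.ncard_univ, Nat.card_eq_fintype_card, Fintype.card_fin] at h1 h2
  omega

/-- `baseGraph` alone has one edge per coordinate and five auxiliary ones. A forest with two
components would fall two short of the promise; the two extra cycle edges make up for it. -/
theorem le_ncard_edgeSet {K : ℕ} (X : Fin K → Fin N → Bool) (y : Fin N → Bool) :
    5 + N ≤ (unionGraph (hardInput X y)).edgeSet.ncard := by
  set f : Fin (5 + N) → Sym2 (Fin (5 + N)) := Fin.addCases
    (fun a => s(auxVertex N (auxEdge a).1, auxVertex N (auxEdge a).2))
    (fun j => s(auxVertex N (if y j then 1 else 0), coordVertex j)) with hf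
  have hinj : Function.Injective f := by
    intro u v
    refine Fin.addCases (fun a => ?_) (fun j => ?_) u <;>
      refine Fin.addCases (fun b => ?_) (fun l => ?_) v <;>
      simp only [hf, Fin.addCases_left, Fin.addCases_right] <;> intro h
    · simp only [Sym2.eq_iff, auxVertex_inj] at h
      congr 1
      revert a b
      decide
    · have : coordVertex l ∈ s(auxVertex N (auxEdge a).1, auxVertex N (auxEdge a).2) := by
        rw [h]; exact Sym2.mem_mk_right _ _
      rcases Sym2.mem_iff.1 this with h | h <;> exact absurd h (coordVertex_ne_auxVertex _ _)
    · have : coordVertex j ∈ s(auxVertex N (auxEdge b).1, auxVertex N (auxEdge b).2) := by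
        rw [← h]; exact Sym2.mem_mk_right _ _
      rcases Sym2.mem_iff.1 this with h | h <;> exact absurd h (coordVertex_ne_auxVertex _ _)
    · have : coordVertex j ∈ s(auxVertex N (if y l then 1 else 0), coordVertex l) := by
        rw [← h]; exact Sym2.mem_mk_right _ _
      rcases Sym2.mem_iff.1 this with h | h
      · exact absurd h (coordVertex_ne_auxVertex _ _)
      · exact h
  have hsub : f '' Set.univ ⊆ (unionGraph (hardInput X y)).edgeSet := by
    rintro _ ⟨u, -, rfl⟩
    refine Fin.addCases (fun a => ?_) (fun j => ?_) u
    · simp only [hf, Fin.addCases_left, SimpleGraph.mem_edgeSet]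
      exact base_le X y (baseGraph_adj_aux y a)
    · simp only [hf, Fin.addCases_right, SimpleGraph.mem_edgeSet]
      exact base_le X y (baseGraph_adj_coord y j)
  have := Set.ncard_le_ncard hsub (Set.toFinite _)
  rwa [Set.ncard_image_of_injective _ hinj, Set.ncard_univ, Nat.card_eq_fintype_card,
    Fintype.card_fin] at this

theorem hardInput_mem {K m : ℕ} (hm : 5 + N ≤ m) (X : Fin K → Fin N → Bool) (y : Fin N → Bool) :
    hardInput X y ∈ duplicationInputs (K + 1) (5 + N) (5 + N) (2 * m) :=
  ⟨le_ncard_edgeSet X y, (ncard_edgeSet_le X y).trans (by omega)⟩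

theorem connectivity_hardInput_eq_true {K : ℕ} (X : Fin K → Fin N → Bool) (y : Fin N → Bool)
    {i : Fin K} {j : Fin N} (hX : X i j = true) (hy : y j = true) :
    connectivity (hardInput X y) = true := by
  simp only [connectivity, decide_eq_true_eq]
  rw [SimpleGraph.connected_iff_exists_forall_reachable]
  have hbase : ∀ l, (unionGraph (hardInput X y)).Adj (auxVertex N (if y l then 1 else 0))
      (coordVertex l) := fun l => base_le X y (baseGraph_adj_coord y l)
  have haux : ∀ a, (unionGraph (hardInput X y)).Adj (auxVertex N (auxEdge a).1)
      (auxVertex N (auxEdge a).2) := fun a => base_le X y (baseGraph_adj_aux y a)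
  have h1 : (unionGraph (hardInput X y)).Reachable (auxVertex N 0) (auxVertex N 1) := by
    have e1 : (unionGraph (hardInput X y)).Adj (auxVertex N 0) (coordVertex j) :=
      (unionGraph_hardInput_adj X y _ _).2 (Or.inr ⟨i, starGraph_adj _ hX⟩)
    have e2 := hbase j
    rw [hy] at e2
    exact e1.reachable.trans e2.reachable.symm
  refine ⟨auxVertex N 0, fun u => Fin.addCases (fun a => ?_) (fun l => ?_) u⟩
  · fin_cases a
    exacts [SimpleGraph.Reachable.refl _, h1, (haux 0).reachable, (haux 1).reachable,
      (haux 2).reachable]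
  · have e := hbase l
    cases hl : y l
    · rw [hl] at e
      exact e.reachable
    · rw [hl] at e
      exact h1.trans e.reachable

theorem connectivity_hardInput_eq_false {K : ℕ} (X : Fin K → Fin N → Bool) (y : Fin N → Bool)
    (hd : ∀ i j, ¬ (X i j = true ∧ y j = true)) : connectivity (hardInput X y) = false := by
  simp only [connectivity, decide_eq_false_iff_not]
  intro hc
  -- A two-colouring that is constant along edges and separates `auxVertex 1` from `auxVertex 0`.
  set col : Fin (5 + N) → Bool := Fin.addCases (fun a => decide (a = 1)) y with hcol
  have hcolAux : ∀ a, col (auxVertex N a) = decide (a = 1) := fun a => Fin.addCases_left _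
  have hcolCoord : ∀ j, col (coordVertex j) = y j := fun j => Fin.addCases_right _
  have hadj : ∀ u v, (unionGraph (hardInput X y)).Adj u v → col u = col v := fun u v h => by
    refine unionGraph_hardInput_cases (p := fun u v => col u = col v) (fun _ _ h => h.symm)
      ?_ ?_ ?_ h
    · intro a
      rw [hcolAux, hcolAux]
      revert a
      decide
    · intro j
      rw [hcolAux, hcolCoord]
      cases y j <;> rfl
    · intro i j hX
      rw [hcolAux, hcolCoord]
      cases hy : y j
      · rfl
      · exact absurd ⟨hX, hy⟩ (hd i j)
  have hreach : ∀ u v, (unionGraph (hardInput X y)).Reachable u v → col u = col v := by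
    rintro u v ⟨w⟩
    induction w with
    | nil => rfl
    | cons h _ ih => exact (hadj _ _ h).trans ih
  have := hreach _ _ (hc.preconnected (auxVertex N 0) (auxVertex N 1))
  rw [hcolAux, hcolAux] at this
  exact absurd this (by decide)

end HardGraphs
-- Fixing the tapes and assembling the bound.
/-- Averaging over the tapes: some tapes do no worse than average on finitely many weighted
events. The events need not be measurable. -/
theorem exists_tape {Ω ι : Type*} [MeasurableSpace Ω] (μ : Measure Ω) [IsProbabilityMeasure μ]
    [Fintype ι] (w : ι → ℝ) (hw : ∀ i, 0 ≤ w i) (bad : ι → Set Ω)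
    (hbad : ∀ i, μ (bad i) ≤ 1 / 3) :
    ∃ ω, ∑ i, w i * (bad i).indicator (fun _ => 1) ω ≤ (∑ i, w i) / 3 := by
  set f : Ω → ℝ := fun ω => ∑ i, w i * (toMeasurable μ (bad i)).indicator (fun _ => 1) ω with hf
  have hint : ∀ i, Integrable (fun ω =>
      w i * (toMeasurable μ (bad i)).indicator (fun _ => (1 : ℝ)) ω) μ := fun i =>
    ((integrable_const 1).indicator (measurableSet_toMeasurable μ _)).const_mul _
  obtain ⟨ω, hω⟩ := exists_le_integral (integrable_finsetSum Finset.univ fun i _ => hint i)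
  refine ⟨ω, (Finset.sum_le_sum fun i _ => ?_).trans (hω.trans ?_)⟩
  · refine mul_le_mul_of_nonneg_left ?_ (hw i)
    exact Set.indicator_le_indicator_of_subset (subset_toMeasurable μ _) (fun _ => zero_le_one) ω
  · rw [integral_finsetSum _ fun i _ => hint i, Finset.sum_div]
    refine Finset.sum_le_sum fun i _ => ?_
    rw [integral_const_mul, integral_indicator_const _ (measurableSet_toMeasurable μ _),
      smul_eq_mul, mul_one, div_eq_mul_one_div]
    refine mul_le_mul_of_nonneg_left ?_ (hw i)
    rw [measureReal_def, measure_toMeasurable]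
    have := ENNReal.toReal_mono (by norm_num) (hbad i)
    simpa using this

/-- The transcripts contribute at most 2, and the two Boolean components a factor 4. -/
theorem sum_exp_label_le {k : ℕ} (hk : 1 ≤ k) (S : Finset (Transcript k × Bool × Bool)) :
    ∑ v ∈ S, Real.exp (-(Real.log (8 * (k : ℝ) ^ 2) * bits v.1)) ≤ 8 := by
  classical
  have hk' : (0 : ℝ) < k := by exact_mod_cast hk
  have e : ∀ h : Transcript k, Real.exp (-(Real.log (8 * (k : ℝ) ^ 2) * bits h)) =
      (1 / (8 * (k : ℝ) ^ 2)) ^ bits h := fun h => by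
    rw [Real.exp_neg, mul_comm, Real.exp_nat_mul, Real.exp_log (by positivity), one_div, inv_pow]
  simp only [e]
  have hsub : S ⊆ S.image Prod.fst ×ˢ Finset.univ := fun v hv =>
    Finset.mem_product.2 ⟨Finset.mem_image_of_mem _ hv, Finset.mem_univ _⟩
  refine (Finset.sum_le_sum_of_subset_of_nonneg hsub fun _ _ _ => by positivity).trans ?_
  rw [Finset.sum_product]
  simp only [Finset.sum_const, nsmul_eq_mul]
  rw [← Finset.mul_sum]
  have := sum_transcript_le hk (S.image Prod.fst)
  have hc : ((Finset.univ : Finset (Bool × Bool)).card : ℝ) = 4 := by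
    rw [Finset.card_univ]; norm_num
  rw [hc]
  linarith

section LowerBound

variable {K N : ℕ} (P : Protocol (K + 1) (SimpleGraph (Fin (5 + N))) Bool)

open Classical in
/-- Whether the protocol, stopped after `T` steps, answers `true`. -/
noncomputable def accepts (ω : ∀ i, P.Tape i) (T : ℕ) (X : Fin K → Fin N → Bool)
    (y : Fin N → Bool) : ℝ :=
  if P.result (hardInput X y) ω T = true then 1 else 0

/-- Sum of the two-party bounds over the players. Here `384 = 192 * 2`, as each message lies in at
most two views, and `1344 = 192 * (8 - 1)`. -/
theorem sum_accepts_le {D : Set (Fin (K + 1) → SimpleGraph (Fin (5 + N)))} {c : ℕ}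
    (hc : P.cost D ≤ c) (hD : ∀ X y, hardInput X y ∈ D) (ω : ∀ i, P.Tape i) :
    ∑ i : Fin K, ∑ j, ∑ D : Fin N → Bool, ∑ x : Fin N → Bool, ∑ y : Fin N → Bool,
      (∑ X, jointWeight (Function.update (mask y (compl D)) j true) X *
          accepts P ω (c + 1) (Function.update X i (Function.update (mask x D) j true))
            (Function.update (mask y (compl D)) j true) -
        ∑ X, jointWeight (Function.update (mask y (compl D)) j false) X *
          accepts P ω (c + 1) (Function.update X i (Function.update (mask x D) j false))
            (Function.update (mask y (compl D)) j false)) ≤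
      (2 ^ N) ^ 3 * (384 * Real.log (8 * ((K + 1 : ℕ) : ℝ) ^ 2) * c + K * (1344 + N / 6)) := by
  classical
  set lam := Real.log (8 * ((K + 1 : ℕ) : ℝ) ^ 2) with hlam
  have hlam0 : 0 ≤ lam := Real.log_nonneg (by push_cast; nlinarith [(K.cast_nonneg : (0 : ℝ) ≤ K)])
  have hi : ∀ i : Fin K, _ := fun i => player_advantage_le i
    (fun X y => P.label ω (c + 1) i.succ (hardInput X y))
    (fun X X' y y' a a' h => by
      have := P.label_update ω (c + 1) i.succ h
      rw [hardInput_update X y, Function.update_self, hardInput_update X' y' i a',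
        Function.update_idem, ← hardInput_update] at this
      rw [this, ← hardInput_update])
    (fun v => lam * bits v.1) (fun v => if v.2.2 = true then 1 else 0)
    (fun v => by split_ifs <;> norm_num) (fun v => by split_ifs <;> norm_num)
    (sum_exp_label_le (Nat.succ_pos K))
  refine (Finset.sum_le_sum fun i _ => hi i).trans ?_
  rw [Finset.sum_add_distrib, Finset.sum_add_distrib, ← Finset.mul_sum]
  have hlen := sum_masked_length_le
    (fun (i : Fin K) X y => lam * bits (P.label ω (c + 1) i.succ (hardInput X y)).1)
    (lam * (2 * c)) (fun X y => by
      rw [← Finset.mul_sum]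
      refine mul_le_mul_of_nonneg_left ?_ hlam0
      have h1 := sum_bits_view_le (P.history (hardInput X y) ω (c + 1))
      rw [Fin.sum_univ_succ] at h1
      have h2 := P.bits_history_le hc (hD X y) ω (c + 1)
      have h3 : ∑ i : Fin K, bits (view i.succ (P.history (hardInput X y) ω (c + 1))) ≤ 2 * c := by
        omega
      exact_mod_cast h3)
  simp only [Finset.sum_const, Finset.card_univ, Fintype.card_fin, nsmul_eq_mul] at hlen ⊢
  linarith

/-- One tape is chosen for the planted and the unplanted inputs together. Their average errors then
add up to at most 2/3, which leaves an advantage of 1/3. -/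
theorem le_sum_accepts {D : Set (Fin (K + 1) → SimpleGraph (Fin (5 + N)))} {c : ℕ}
    (hc : P.cost D ≤ c) (hD : ∀ X y, hardInput X y ∈ D)
    (hP : P.Computes D connectivity (1 / 3)) : ∃ ω : ∀ i, P.Tape i,
    (2 ^ N) ^ 3 * ((K : ℝ) * N / 3) ≤
    ∑ i : Fin K, ∑ j, ∑ D : Fin N → Bool, ∑ x : Fin N → Bool, ∑ y : Fin N → Bool,
      (∑ X, jointWeight (Function.update (mask y (compl D)) j true) X *
          accepts P ω (c + 1) (Function.update X i (Function.update (mask x D) j true))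
            (Function.update (mask y (compl D)) j true) -
        ∑ X, jointWeight (Function.update (mask y (compl D)) j false) X *
          accepts P ω (c + 1) (Function.update X i (Function.update (mask x D) j false))
            (Function.update (mask y (compl D)) j false)) := by
  classical
  let := P.tapeSpace
  have := P.isProbabilityMeasure_law
  set bad : (Fin K → Fin N → Bool) → (Fin N → Bool) → Set (∀ i, P.Tape i) := fun X y =>
    {ω | ¬ P.Outputs (hardInput X y) ω (connectivity (hardInput X y))} with hbad
  obtain ⟨ω, hω⟩ := exists_tape P.law
    (ι := Fin K × Fin N × (Fin N → Bool) × (Fin N → Bool) × (Fin N → Bool) × Bool ×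
      (Fin K → Fin N → Bool))
    (fun ⟨_, j, D, _, y, τ, X⟩ => jointWeight (Function.update (mask y (compl D)) j τ) X)
    (fun ⟨_, j, D, _, y, τ, X⟩ => jointWeight_nonneg _ _)
    (fun ⟨i, j, D, x, y, τ, X⟩ => bad (Function.update X i (Function.update (mask x D) j τ))
      (Function.update (mask y (compl D)) j τ))
    (fun ⟨i, j, D, x, y, τ, X⟩ => hP _ (hD _ _))
  simp only [Fintype.sum_prod_type, sum_jointWeight, Fintype.sum_bool] at hω
  refine ⟨ω, ?_⟩
  have hacc : ∀ X y, ω ∉ bad X y →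
      P.result (hardInput X y) ω (c + 1) = connectivity (hardInput X y) := fun X y h =>
    (P.outputs_iff hc (hD X y) ω _).1 (not_not.1 h)
  have h1 : ∀ (i : Fin K) j (D x y : Fin N → Bool),
      1 - ∑ X, jointWeight (Function.update (mask y (compl D)) j true) X *
        (bad (Function.update X i (Function.update (mask x D) j true))
          (Function.update (mask y (compl D)) j true)).indicator (fun _ => 1) ω ≤
      ∑ X, jointWeight (Function.update (mask y (compl D)) j true) X *
          accepts P ω (c + 1) (Function.update X i (Function.update (mask x D) j true))
            (Function.update (mask y (compl D)) j true) := fun i j D x y => by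
    refine (sub_le_sub_right
      (sum_jointWeight (L := Fin K) (Function.update (mask y (compl D)) j true)).ge _).trans ?_
    rw [← Finset.sum_sub_distrib]
    refine Finset.sum_le_sum fun X _ => ?_
    rw [← mul_one_sub]
    refine mul_le_mul_of_nonneg_left ?_ (jointWeight_nonneg _ _)
    unfold accepts
    by_cases h : ω ∈ bad (Function.update X i (Function.update (mask x D) j true))
          (Function.update (mask y (compl D)) j true)
    · rw [Set.indicator_of_mem h]
      split_ifs <;> norm_num
    · rw [Set.indicator_of_notMem h, hacc _ _ h,
        connectivity_hardInput_eq_true (i := i) (j := j) _ _ (by simp) (by simp)]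
      norm_num
  have h0 : ∀ (i : Fin K) j (D x y : Fin N → Bool),
      ∑ X, jointWeight (Function.update (mask y (compl D)) j false) X *
          accepts P ω (c + 1) (Function.update X i (Function.update (mask x D) j false))
            (Function.update (mask y (compl D)) j false) ≤
      ∑ X, jointWeight (Function.update (mask y (compl D)) j false) X *
        (bad (Function.update X i (Function.update (mask x D) j false))
          (Function.update (mask y (compl D)) j false)).indicator (fun _ => 1) ω := fun i j D x y => by
    refine Finset.sum_le_sum fun X _ => ?_
    -- Only inputs of positive weight are guaranteed to be disjoint from `y`.
    by_cases hz : jointWeight (Function.update (mask y (compl D)) j false) X = 0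
    · rw [hz, zero_mul, zero_mul]
    refine mul_le_mul_of_nonneg_left ?_ (jointWeight_nonneg _ _)
    unfold accepts
    by_cases h : ω ∈ bad (Function.update X i (Function.update (mask x D) j false))
          (Function.update (mask y (compl D)) j false)
    · rw [Set.indicator_of_mem h]
      split_ifs <;> norm_num
    · rw [Set.indicator_of_notMem h, hacc _ _ h, connectivity_hardInput_eq_false]
      · norm_num
      · intro l q
        by_cases hl : l = i
        · subst hl
          by_cases hq : q = j
          · subst hq; simp
          · simp [hq, mask, compl]
            tauto
        · rw [Function.update_of_ne hl]
          exact disjoint_of_inputWeight_ne_zero (Finset.prod_ne_zero_iff.1 hz l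
            (Finset.mem_univ l)) q
  refine le_trans ?_ (Finset.sum_le_sum fun i _ => Finset.sum_le_sum fun j _ =>
    Finset.sum_le_sum fun D _ => Finset.sum_le_sum fun x _ => Finset.sum_le_sum fun y _ =>
      sub_le_sub (h1 i j D x y) (h0 i j D x y))
  simp only [sub_sub]
  simp only [Finset.sum_sub_distrib, Finset.sum_const, Finset.card_univ, Fintype.card_fin,
    Fintype.card_pi, Fintype.card_bool, Finset.prod_const, nsmul_eq_mul] at hω ⊢
  push_cast at hω ⊢
  linarith

theorem cost_lower_bound {D : Set (Fin (K + 1) → SimpleGraph (Fin (5 + N)))} {c : ℕ}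
    (hc : P.cost D ≤ c) (hD : ∀ X y, hardInput X y ∈ D)
    (hP : P.Computes D connectivity (1 / 3)) :
    (K : ℝ) * (N / 6 - 1344) ≤ 384 * Real.log (8 * ((K + 1 : ℕ) : ℝ) ^ 2) * c := by
  obtain ⟨ω, hω⟩ := le_sum_accepts P hc hD hP
  have := le_of_mul_le_mul_left (hω.trans (sum_accepts_le P hc hD ω)) (by positivity)
  linarith

/-- For `n ≥ 20000` the bracket is at least `n / 12`; also `k - 1 ≥ k / 2` and `8 * k ^ 2 ≤ k ^ 5`.
The constant becomes `24 * 1920 = 46080 ≤ 50000`. -/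
theorem kn_div_log_le {n k c : ℕ} (hn : 20000 ≤ n) (hk : 2 ≤ k)
    (h : ((k - 1 : ℕ) : ℝ) * (((n - 5 : ℕ) : ℝ) / 6 - 1344) ≤
      384 * Real.log (8 * (k : ℝ) ^ 2) * c) :
    1 / 50000 * ((k : ℝ) * n / Real.logb 2 k) ≤ c := by
  have hk' : (2 : ℝ) ≤ k := by exact_mod_cast hk
  have hn' : (20000 : ℝ) ≤ n := by exact_mod_cast hn
  rw [Nat.cast_sub (by omega), Nat.cast_sub (by omega)] at h
  push_cast at h
  have hl2 : Real.log 2 ≤ 1 := by linarith [Real.log_two_lt_d9]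
  have hl2' : 0 < Real.log 2 := Real.log_pos (by norm_num)
  have hlogk : 0 < Real.log k := Real.log_pos (by linarith)
  have hll : Real.log k ≤ Real.logb 2 k := by
    rw [Real.logb, le_div_iff₀ hl2']
    nlinarith
  have hL : Real.log (8 * (k : ℝ) ^ 2) ≤ 5 * Real.log k := by
    have e : (5 : ℝ) * Real.log k = Real.log ((k : ℝ) ^ 5) := by rw [Real.log_pow]; norm_num
    rw [e]
    refine Real.log_le_log (by positivity) ?_
    have : (2 : ℝ) ^ 3 ≤ (k : ℝ) ^ 3 := by gcongr
    nlinarith [sq_nonneg (k : ℝ)]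
  have hc0 : (0 : ℝ) ≤ c := c.cast_nonneg
  have h1 : (384 : ℝ) * Real.log (8 * (k : ℝ) ^ 2) * c ≤ 1920 * Real.logb 2 k * c := by
    refine mul_le_mul_of_nonneg_right ?_ hc0
    linarith
  have h2 : (k : ℝ) / 2 * (n / 12) ≤ (k - 1) * ((n - 5) / 6 - 1344) :=
    mul_le_mul (by linarith) (by linarith) (by positivity) (by linarith)
  have hlb : 0 < Real.logb 2 k := by linarith
  rw [← mul_div_assoc, div_le_iff₀ hlb]
  have : (0 : ℝ) ≤ k * n := by positivity
  nlinarith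

end LowerBound

end MessagePassing

theorem mainTheorem6 :
    ∃ C : ℝ, 0 < C ∧ ∃ c : ℝ, 0 < c ∧
      ∀ n m k : ℕ, n ≤ m → C * Real.logb 2 n ≤ k → k ≤ min n m →
        ENNReal.ofReal (c * (k * n / Real.logb 2 k)) ≤
          (MessagePassing.randComm (MessagePassing.duplicationInputs k n n (2 * m))
            MessagePassing.connectivity (1 / 3) : ENNReal) := by
  -- For `k ≥ 2` we have `logb 2 n ≥ 1`, so `C = 20000` forces `n ≥ k ≥ 20000`.
  refine ⟨20000, by norm_num, 1 / 50000, by norm_num, fun n m k hnm hC hk => ?_⟩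
  have hkn : k ≤ n := hk.trans (min_le_left _ _)
  rcases Nat.lt_or_ge k 2 with hk2 | hk2
  · have h0 : Real.logb 2 k = 0 := by interval_cases k <;> simp
    rw [h0]
    simp
  have hn2 : (2 : ℝ) ≤ n := by exact_mod_cast hk2.trans hkn
  have hlog : 1 ≤ Real.logb 2 n := by
    rw [Real.le_logb_iff_rpow_le (by norm_num) (by linarith)]
    simpa using hn2
  have hn : 20000 ≤ n := by
    have h1 : (20000 : ℝ) ≤ k := by linarith
    have h2 : 20000 ≤ k := by exact_mod_cast h1
    omega
  set r : ℝ := 1 / 50000 * (k * n / Real.logb 2 k) with hr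
  have hceil : ((⌈r⌉₊ : ℕ) : ℕ∞) ≤
      MessagePassing.randComm (MessagePassing.duplicationInputs k n n (2 * m))
        MessagePassing.connectivity (1 / 3) := by
    refine le_iInf₂ fun P hP => ?_
    obtain ⟨K, rfl⟩ : ∃ K, k = K + 1 := ⟨k - 1, by omega⟩
    obtain ⟨N, rfl⟩ : ∃ N, n = 5 + N := ⟨n - 5, by omega⟩
    rcases eq_or_ne (P.cost (MessagePassing.duplicationInputs (K + 1) (5 + N) (5 + N) (2 * m))) ⊤
      with htop | htop
    · rw [htop]; exact le_top
    obtain ⟨c, hc⟩ := ENat.ne_top_iff_exists.1 htop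
    rw [← hc]
    refine Nat.cast_le.2 (Nat.ceil_le.2 (MessagePassing.kn_div_log_le hn hk2 ?_))
    have := MessagePassing.cost_lower_bound P hc.symm.le
      (fun X y => MessagePassing.hardInput_mem hnm X y) hP
    simpa using this
  calc ENNReal.ofReal r ≤ ENNReal.ofReal (⌈r⌉₊ : ℝ) := ENNReal.ofReal_le_ofReal (Nat.le_ceil r)
    _ = (((⌈r⌉₊ : ℕ) : ℕ∞) : ENNReal) := by simp
    _ ≤ _ := by exact_mod_cast hceil
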